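/- Let $F$ be a field of characteristic $\neq 2$. A discrete valuation is called dyadic if its residue field has characteristic $2$. Identify $H^2(F,\mathbb{Z}/2)$ with the $2$-torsion of the Brauer group of $F$, and let $H^2_u(F)\subseteq H^2(F,\mathbb{Z}/2)$ be the subgroup of classes that are unramified (have zero residue) at every nondyadic discrete valuation of $F$ and are killed by $H^2(F,\mathbb{Z}/2)\to H^2(R,\mathbb{Z}/2)$ for every real closure $R$ of $F$. For a complete discretely valued field $\hat F$ with residue field $\bar F$, let $\hat F_{nr}$ be its maximal unramified extension, that is, the union of the finite unramified extensions of $\hat F$ with separable residue field extension. The ramification map is the homomorphism from the $2$-torsion of $\mathrm{Br}(\hat F_{nr}/\hat F)=H^2(\mathrm{Gal}(\hat F_{nr}/\hat F),\hat F_{nr}^\times)$ to $H^1(\bar F,\mathbb{Z}/2)$ induced by the valuation $\hat F_{nr}^\times\to\mathbb{Z}$ and the identification $H^2(\mathrm{Gal}(\hat F_{nr}/\hat F),\mathbb{Z})\cong H^1(\bar F,\mathbb{Q}/\mathbb{Z})$. The field $F$ is called transparent if for every finite-dimensional central division $F$-algebra $D\neq F$ of exponent $2$ with $[D]\in H^2_u(F)$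 there is a dyadic discrete valuation of $F$, with completion $\hat F$, such that (1) $D\otimes_F\hat F$ is split by the maximal unramified extension of $\hat F$, and (2) the image of $[D\otimes_F\hat F]$ under the ramification map in $H^1(\bar F,\mathbb{Z}/2)$ is not zero. **Theorem.** Let $F$ be a field of characteristic $\neq 2$ that is transparent. If $D_1$ and $D_2$ are quaternion division algebras over $F$ that have the same maximal subfields (every maximal subfield of one is isomorphic over $F$ to a maximal subfield of the other), then $D_1$ and $D_2$ are isomorphic as $F$-algebras. -/

import Mathlib

open scoped TensorProduct WithZero

noncomputable section

universe u

/-! ### Central simple algebras: splitting, Brauer equivalence, crossed products -/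

/-- The `E`-algebra `A` is split: it is a full matrix algebra over `E`. -/
def IsSplitAlgebra (E A : Type*) [Field E] [Ring A] [Algebra E A] : Prop :=
  ∃ n : ℕ, n ≠ 0 ∧ Nonempty (A ≃ₐ[E] Matrix (Fin n) (Fin n) E)

/-- The `F`-algebra `A` is split by the field extension `E` of `F`, that is, its class is killed by
restriction from `F` to `E`. -/
def IsSplitBy (F E A : Type*) [Field F] [Field E] [Algebra F E] [Ring A] [Algebra F A] : Prop :=
  IsSplitAlgebra E (E ⊗[F] A)

/-- Brauer equivalence of central simple algebras (the relation used by Mathlib's `BrauerGroup`, for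
unbundled algebras). -/
def BrauerEquivalent (E A B : Type*) [Field E] [Ring A] [Algebra E A] [Ring B] [Algebra E B] :
    Prop :=
  ∃ n m : ℕ, n ≠ 0 ∧ m ≠ 0 ∧
    Nonempty (Matrix (Fin n) (Fin n) A ≃ₐ[E] Matrix (Fin m) (Fin m) B)

/-- `C` is the crossed product algebra `(L/E, f)`, for a finite Galois extension `L/E` with group
`G` and `f : G × G → Lˣ`. That is, `C = ⨁ σ, L u_σ` with `u_σ x = σ(x) u_σ` for `x` in `L` and
`u_σ u_τ = f(σ, τ) u_{στ}`. (Associativity of `C` makes `f` a 2-cocycle.) Its Brauer class is the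
image of the class of `f` under `H²(G, Lˣ) ≅ Br(L/E)`. -/
def IsCrossedProduct (E L C : Type*) [Field E] [Field L] [Algebra E L] [FiniteDimensional E L]
    [Ring C] [Algebra E C] (f : Gal(L/E) → Gal(L/E) → Lˣ) : Prop :=
  ∃ (ι : L →ₐ[E] C) (u : Gal(L/E) → Cˣ),
    (∀ (σ : Gal(L/E)) (x : L), (u σ : C) * ι x = ι (σ x) * u σ) ∧
    (∀ σ τ : Gal(L/E), (u σ : C) * u τ = ι (f σ τ) * u (σ * τ)) ∧
    Function.Bijective fun x : Gal(L/E) → L => ∑ σ, ι (x σ) * (u σ : C)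

/-! ### Unramified extensions -/

/-- `L/E` is a finite extension, and the (normalised discrete) valuation `w` of `L` extends the
valuation `v` of `E` with the same values (ramification index one) and with separable residue
field extension. -/
def IsUnramifiedExtension {E L : Type*} [Field E] [Field L] [Algebra E L]
    (v : Valuation E ℤᵐ⁰) (w : Valuation L ℤᵐ⁰) : Prop :=
  FiniteDimensional E L ∧ w.comap (algebraMap E L) = v ∧
    ∃ _ : v.HasExtension w,
      Algebra.IsSeparable (IsLocalRing.ResidueField v.valuationSubring)
        (IsLocalRing.ResidueField w.valuationSubring)

/-- The maximal unramified extension of a complete discretely valued field `E`: the union, inside an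
algebraic closure, of the finite unramified extensions of `E` (with separable residue field). -/
def maximalUnramifiedExtension {E : Type*} [Field E] (v : Valuation E ℤᵐ⁰) :
    IntermediateField E (AlgebraicClosure E) :=
  ⨆ L ∈ {L : IntermediateField E (AlgebraicClosure E) |
    ∃ w : Valuation L ℤᵐ⁰, IsUnramifiedExtension v w}, L

/-! ### The ramification map -/

/-- For a normalised discrete valuation `w` on `L` invariant under `G = Gal(L/E)`, the image of the
class of a 2-cocycle `f` under
`H²(G, Lˣ) → H²(G, ℤ) ≅ H¹(G, ℚ/ℤ) = Hom(G, ℚ/ℤ)`, where the first map is induced by the additive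
valuation `-log w`. The inverse of the connecting isomorphism `H¹(G, ℚ/ℤ) ≅ H²(G, ℤ)` sends the
class of a cocycle `c` to the character `σ ↦ |G|⁻¹ ∑ τ, c(σ, τ)` modulo `ℤ`: indeed, summing the
cocycle identity of `c` shows that `c` is the coboundary of the rational cochain
`σ ↦ |G|⁻¹ ∑ τ, c(σ, τ)`. -/
def ramificationCharacter {E L : Type*} [Field E] [Field L] [Algebra E L] [FiniteDimensional E L]
    (w : Valuation L ℤᵐ⁰) (f : Gal(L/E) → Gal(L/E) → Lˣ) (σ : Gal(L/E)) : AddCircle (1 : ℚ) :=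
  (((∑ τ : Gal(L/E), -((WithZero.log (w (f σ τ)) : ℤ) : ℚ)) / (Fintype.card Gal(L/E) : ℚ) : ℚ) :
    AddCircle (1 : ℚ))

/-- `χ` is the ramification of the central simple algebra `A` over the complete discretely valued
field `(E, v)`, computed over the finite unramified Galois extension `(L, w)`: the class of `A` in
`Br(L/E) = H²(Gal(L/E), Lˣ)` is represented by a cocycle with ramification character `χ`.
Here `Gal(L/E)` is the Galois group of the residue field extension, so `Hom(Gal(L/E), ℚ/ℤ)` is a
subgroup of `H¹(Ē, ℚ/ℤ)` for the residue field `Ē`; if `A` has exponent two, `χ` is in `H¹(Ē, ℤ/2)`.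
-/
def HasRamification {E : Type u} [Field E] (v : Valuation E ℤᵐ⁰) (A : Type*) [Ring A] [Algebra E A]
    {L : Type u} [Field L] [Algebra E L] (w : Valuation L ℤᵐ⁰)
    (χ : Gal(L/E) → AddCircle (1 : ℚ)) : Prop :=
  IsUnramifiedExtension v w ∧ IsGalois E L ∧ ∃ _ : FiniteDimensional E L,
    ∃ (C : Type u) (_ : Ring C) (_ : Algebra E C) (f : Gal(L/E) → Gal(L/E) → Lˣ),
      IsCrossedProduct E L C f ∧ BrauerEquivalent E A C ∧ χ = ramificationCharacter w f

/-- The class of `A` over the complete discretely valued field `(E, v)` is split by the maximal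
unramified extension and has ramification zero. -/
def RamificationZero {E : Type u} [Field E] (v : Valuation E ℤᵐ⁰) (A : Type*) [Ring A]
    [Algebra E A] : Prop :=
  ∃ (L : Type u) (_ : Field L) (_ : Algebra E L) (w : Valuation L ℤᵐ⁰)
    (χ : Gal(L/E) → AddCircle (1 : ℚ)), HasRamification v A w χ ∧ χ = 0

/-- The class of `A` over the complete discretely valued field `(E, v)` has nonzero ramification. -/
def RamificationNonzero {E : Type u} [Field E] (v : Valuation E ℤᵐ⁰) (A : Type*) [Ring A]
    [Algebra E A] : Prop :=
  ∃ (L : Type u) (_ : Field L) (_ : Algebra E L) (w : Valuation L ℤᵐ⁰)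
    (χ : Gal(L/E) → AddCircle (1 : ℚ)), HasRamification v A w χ ∧ χ ≠ 0

/-! ### Discrete valuations and unramified classes of a field -/

/-- A (normalised) discrete valuation: the value group is all of `ℤ`. -/
def IsDiscreteValuation {F : Type*} [Field F] (v : Valuation F ℤᵐ⁰) : Prop :=
  Function.Surjective v

/-- A valuation is dyadic if its residue field has characteristic two. -/
def IsDyadic {F : Type*} [Field F] (v : Valuation F ℤᵐ⁰) : Prop :=
  ringChar (IsLocalRing.ResidueField v.valuationSubring) = 2

/-- The valuation of the completion of `F` at `v`. -/
abbrev completionValuation {F : Type*} [Field F] (v : Valuation F ℤᵐ⁰) :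
    Valuation v.Completion ℤᵐ⁰ :=
  Valued.v

/-- Scalar multiplication by `F` is uniformly continuous for the topology of `v`; this provides the
`F`-algebra structure of the completion of `F` at `v`. -/
instance valuationUniformContinuousConstSMul {F : Type*} [Field F] (v : Valuation F ℤᵐ⁰) :
    UniformContinuousConstSMul F (WithVal v) := by
  refine ⟨fun l => ?_⟩
  simp_rw [WithVal.smul_right_def]
  exact (Ring.uniformContinuousConstSMul (WithVal v)).uniformContinuous_const_smul (WithVal.toVal v l)

/-- For a central division algebra `D` over `F` of exponent dividing two: the class of `D` is in
`H²_u(F)`, that is, it is unramified at every nondyadic discrete valuation of `F` and is killed by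
every real closure of `F`. (The real closures of `F` for its various orderings are the real closed
fields that are algebraic over `F`.) -/
def IsUnramifiedClass (F : Type u) [Field F] (D : Type*) [Ring D] [Algebra F D] : Prop :=
  (∀ v : Valuation F ℤᵐ⁰, IsDiscreteValuation v → ¬ IsDyadic v →
    RamificationZero (completionValuation v) (v.Completion ⊗[F] D)) ∧
  (∀ (R : Type u) [Field R] [Algebra F R], IsRealClosed R → Algebra.IsAlgebraic F R →
    IsSplitBy F R D)

/-- A field `F` (of characteristic not two) is transparent if for every central division algebra
`D ≠ F` of exponent two whose class is in `H²_u(F)` there is a dyadic discrete valuation `v` of `F`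
such that, over the completion, `D` is split by the maximal unramified extension and has nonzero
ramification. -/
def IsTransparent (F : Type u) [Field F] : Prop :=
  ∀ (D : Type u) [DivisionRing D] [Algebra F D] [Algebra.IsCentral F D] [FiniteDimensional F D],
    Module.finrank F D ≠ 1 → IsSplitAlgebra F (D ⊗[F] D) → IsUnramifiedClass F D →
    ∃ v : Valuation F ℤᵐ⁰, IsDiscreteValuation v ∧ IsDyadic v ∧
      IsSplitBy v.Completion (maximalUnramifiedExtension (completionValuation v))
        (v.Completion ⊗[F] D) ∧
      RamificationNonzero (completionValuation v) (v.Completion ⊗[F] D)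

/-! ### Maximal subfields -/

/-- A maximal subfield of a division algebra `D` with centre `F`. -/
def IsMaximalSubfield {F D : Type*} [Field F] [Ring D] [Algebra F D] (K : Subalgebra F D) : Prop :=
  Maximal (fun S : Subalgebra F D => IsField S) K

/-- `D₁` and `D₂` have the same maximal subfields, up to isomorphism over `F`. -/
def HaveSameMaximalSubfields (F D₁ D₂ : Type*) [Field F] [Ring D₁] [Algebra F D₁]
    [Ring D₂] [Algebra F D₂] : Prop :=
  (∀ K₁ : Subalgebra F D₁, IsMaximalSubfield K₁ →
    ∃ K₂ : Subalgebra F D₂, IsMaximalSubfield K₂ ∧ Nonempty (K₁ ≃ₐ[F] K₂)) ∧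
  (∀ K₂ : Subalgebra F D₂, IsMaximalSubfield K₂ →
    ∃ K₁ : Subalgebra F D₁, IsMaximalSubfield K₁ ∧ Nonempty (K₁ ≃ₐ[F] K₂))

end

/-! A noncentral root of some `s` in `F` generates a maximal subfield of `D₁`, so `s` has a
noncentral root in `D₂` too and `Dᵢ = (s, tᵢ)`. The class of `D₁ ⊗ D₂` is that of `(s, t₁ t₂)`, and
`D₁ ≅ D₂` once `t₁ t₂` is a norm from `F(√s)`. Otherwise `(s, t₁ t₂)` is a division algebra of
exponent two. It contradicts transparency because its class lies in `H²_u` (`isUnramifiedClass`) and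
it has no nonzero ramification at any dyadic valuation (`not_ramificationNonzero_tensor`).

The subfields enter only through one consequence: the pure parts of `(s, t₁)` and `(s, t₂)` have the
same nonzero squares in `F` (`Represents`). This passes to completions, since nearby nonzero
elements differ by a square factor (`represents_of_denseRange`); in a real closure with `s < 0` it
makes the signs of `t₁` and `t₂` agree (`isNorm_of_isRealClosed`).

Over a completion (`split_or_exists_noResidualRoot`) the two algebras are both split or both
division. In the division case `v ∘ nrd` is a valuation, and `(s, t₁)` contains an `x` whose
polynomial `X² - aX + b` has no root in the residue field (`exists_noResidualRoot`). Its
discriminant `δ` is a pure square in both algebras, so they become `(δ, r₁)` and `(δ, r₂)`, with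
`(s, t₁ t₂) ≅ (δ, r₁ r₂)`. If `v δ = 1`, then `r₁` and `r₂` have values of the same parity: `r₂` is
a pure square of `(δ, r₁)`, where all norms have even value if `r₁` has. So `r₁ r₂` has even value.
In the nondyadic case `v δ = 1` always holds and `(δ, unit)` is unramified.

In the dyadic case let the ramification be computed from a cocycle `f` over an unramified Galois
extension `L`. The Brauer equivalence yields an `L`-plane on which the crossed product acts by
semilinear operators `u σ` commuting with the quaternion algebra. If `u σ p = α p + β Y p` for a
quaternion `Y`, the norms `N σ` of `α + β Y` satisfy `σ(N τ) N σ = f(σ, τ)² N(σ τ)`. When the `N σ`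
have even value, halving shows that the valuation of `f` is an integral coboundary. If `X² - aX + b`
still has no residual root over `L`, take `Y = (a + √δ)/2`. Otherwise separability of the residue
extension forces `v δ = 1` and `√δ ∈ L`; then `r₁ r₂` has even value, and `Y = j` works with `p` an
eigenvector of `i`. -/

open scoped Quaternion

universe u

/-! ### Quaternion algebras -/

/-- A ring of dimension four containing anticommuting square roots of `s` and `t` is the
quaternion algebra `(s, t)`. -/
theorem quaternionAlgebra_equiv_of_anticommute {F A : Type*} [Field F] [Ring A] [Algebra F A]
    (h2 : (2 : F) ≠ 0) {s t : F} (hs : s ≠ 0) (ht : t ≠ 0) (hA : Module.finrank F A = 4)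
    (I J : A) (hI : I * I = algebraMap F A s) (hJ : J * J = algebraMap F A t)
    (hIJ : J * I = -(I * J)) :
    ∃ e : ℍ[F,s,0,t] ≃ₐ[F] A, e ⟨0, 1, 0, 0⟩ = I ∧ e ⟨0, 0, 1, 0⟩ = J := by
  have hnt : Nontrivial A := by
    by_contra h
    rw [not_nontrivial_iff_subsingleton] at h
    simp [Module.finrank_zero_of_subsingleton] at hA
  let q : QuaternionAlgebra.Basis A s 0 t :=
    { i := I, j := J, k := I * J
      i_mul_i := by rw [hI, zero_smul, add_zero, Algebra.algebraMap_eq_smul_one]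
      j_mul_j := by rw [hJ, Algebra.algebraMap_eq_smul_one]
      i_mul_j := rfl
      j_mul_i := by rw [hIJ, zero_smul, zero_sub] }
  have hfin : FiniteDimensional F A := .of_finrank_pos (by omega)
  have hinj : Function.Injective q.liftHom := by
    rw [injective_iff_map_eq_zero]
    rintro ⟨a, b, c, d⟩ h0
    have h : a • (1 : A) + b • I + c • J + d • (I * J) = 0 := by
      simpa [QuaternionAlgebra.Basis.lift, q, Algebra.algebraMap_eq_smul_one] using h0
    have hII : I * I = s • (1 : A) := by rw [hI, Algebra.algebraMap_eq_smul_one]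
    have hJJ : J * J = t • (1 : A) := by rw [hJ, Algebra.algebraMap_eq_smul_one]
    have hIIJ : I * (I * J) = s • J := by rw [← mul_assoc, hII, smul_mul_assoc, one_mul]
    have hIJI : (I * J) * I = -(s • J) := by rw [mul_assoc, hIJ, mul_neg, hIIJ]
    have hJIJ : J * (I * J) = -(t • I) := by
      rw [← mul_assoc, hIJ, neg_mul, mul_assoc, hJJ, mul_smul_comm, mul_one]
    have hIJJ : (I * J) * J = t • I := by rw [mul_assoc, hJJ, mul_smul_comm, mul_one]
    -- The anticommutator with `I` kills the terms in `J` and `I * J`; a second anticommutator, with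
    -- `J`, isolates `b`. The same device then isolates the other coefficients.
    have e1 := congrArg (fun z => I * z) h
    have e2 := congrArg (fun z => z * I) h
    simp only [mul_add, add_mul, mul_smul_comm, smul_mul_assoc, mul_one, one_mul, hII, hIJ,
      hIIJ, hIJI, mul_zero, zero_mul] at e1 e2
    have e3 : (2 * s * b) • (1 : A) + (2 * a) • I = 0 := by
      linear_combination (norm := module) e1 + e2
    have e4 := congrArg (fun z => J * z) e3
    have e5 := congrArg (fun z => z * J) e3
    simp only [mul_add, add_mul, mul_smul_comm, smul_mul_assoc, mul_one, one_mul, hIJ,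
      mul_zero, zero_mul] at e4 e5
    have e6 : (4 * s * b) • J = 0 := by linear_combination (norm := module) e4 + e5
    have e7 := congrArg (fun z => z * J) e6
    simp only [smul_mul_assoc, hJJ, zero_mul, smul_smul] at e7
    have h4 : (4 : F) ≠ 0 := by
      have : (4 : F) = 2 * 2 := by norm_num
      rw [this]; exact mul_ne_zero h2 h2
    have hb : b = 0 := by simpa [hs, ht, h4] using e7
    subst hb
    have e8 := congrArg (fun z => z * I) e3
    simp only [mul_zero, zero_smul, zero_add, smul_mul_assoc, hII, smul_smul, zero_mul] at e8
    have ha : a = 0 := by simpa [hs, h2] using e8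
    subst ha
    have e9 : c • J + d • (I * J) = 0 := by simpa using h
    have e10 := congrArg (fun z => z * J) e9
    simp only [add_mul, smul_mul_assoc, hJJ, hIJJ, zero_mul] at e10
    have e11 := congrArg (fun z => J * z) e10
    have e12 := congrArg (fun z => z * J) e10
    simp only [mul_add, add_mul, mul_smul_comm, smul_mul_assoc, mul_one, one_mul, hIJ,
      mul_zero, zero_mul] at e11 e12
    have e13 : (2 * c * t) • J = 0 := by linear_combination (norm := module) e11 + e12
    have e14 := congrArg (fun z => z * J) e13
    simp only [smul_mul_assoc, hJJ, zero_mul, smul_smul] at e14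
    have hc : c = 0 := by simpa [ht, h2] using e14
    subst hc
    have e15 := congrArg (fun z => z * I) e10
    simp only [zero_smul, zero_add, smul_mul_assoc, hII, smul_smul, zero_mul] at e15
    have hd : d = 0 := by simpa [ht, hs] using e15
    subst hd
    rfl
  have hbij : Function.Bijective q.liftHom := by
    refine ⟨hinj, ?_⟩
    exact (LinearMap.injective_iff_surjective_of_finrank_eq_finrank
      (f := q.liftHom.toLinearMap) (by rw [hA, QuaternionAlgebra.finrank_eq_four])).1 hinj
  refine ⟨AlgEquiv.ofBijective q.liftHom hbij, ?_, ?_⟩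
  · simp [QuaternionAlgebra.Basis.lift, q]
  · simp [QuaternionAlgebra.Basis.lift, q]

/-! ### Calculus of symbols: norms, pure squares, change of slots -/

namespace QuaternionPair

variable {F : Type*} [Field F]

/-- The quaternion algebras `(s, t)` and `(s', t')` are isomorphic. -/
def Iso (s t s' t' : F) : Prop := Nonempty (ℍ[F,s,0,t] ≃ₐ[F] ℍ[F,s',0,t'])

/-- The value of the pure part of the quaternion algebra `(s, t)`: the square of
`a i + b j + c k`. -/
def pureSq (s t a b c : F) : F := s * a ^ 2 + t * b ^ 2 - s * t * c ^ 2

/-- `r` is the square of a pure quaternion of `(s, t)`. -/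
def Represents (s t r : F) : Prop := ∃ a b c : F, pureSq s t a b c = r

/-- `r` is a norm from `F(√s)`. -/
def IsNorm (s r : F) : Prop := ∃ x y : F, r = x ^ 2 - s * y ^ 2

/-- The reduced norm. -/
def nrd {s t : F} (x : ℍ[F,s,0,t]) : F :=
  x.re ^ 2 - s * x.imI ^ 2 - t * x.imJ ^ 2 + s * t * x.imK ^ 2

/-- The quaternion algebra `(s, t)` has anisotropic norm form. -/
def IsDivision (s t : F) : Prop := ∀ x : ℍ[F,s,0,t], nrd x = 0 → x = 0

theorem nrd_mul {s t : F} (x y : ℍ[F,s,0,t]) : nrd (x * y) = nrd x * nrd y := by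
  simp only [nrd, QuaternionAlgebra.re_mul, QuaternionAlgebra.imI_mul, QuaternionAlgebra.imJ_mul,
    QuaternionAlgebra.imK_mul]
  ring

theorem nrd_star {s t : F} (x : ℍ[F,s,0,t]) : nrd (star x) = nrd x := by
  simp [nrd]

theorem nrd_coe {s t : F} (r : F) : nrd (r : ℍ[F,s,0,t]) = r ^ 2 := by
  simp [nrd]

theorem nrd_smul {s t : F} (r : F) (x : ℍ[F,s,0,t]) : nrd (r • x) = r ^ 2 * nrd x := by
  simp [nrd]; ring

theorem self_mul_star {s t : F} (x : ℍ[F,s,0,t]) : x * star x = QuaternionAlgebra.coe (nrd x) := by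
  ext <;> simp <;> (try simp only [nrd]) <;> ring

theorem star_mul_self {s t : F} (x : ℍ[F,s,0,t]) : star x * x = QuaternionAlgebra.coe (nrd x) := by
  ext <;> simp <;> (try simp only [nrd]) <;> ring

theorem Iso.symm {s t s' t' : F} (h : Iso s t s' t') : Iso s' t' s t := h.map AlgEquiv.symm

theorem Iso.trans {s t s' t' s'' t'' : F} (h : Iso s t s' t') (h' : Iso s' t' s'' t'') :
    Iso s t s'' t'' := by
  obtain ⟨e⟩ := h
  obtain ⟨e'⟩ := h'
  exact ⟨e.trans e'⟩

theorem iso_swap (s t : F) : Iso s t t s := ⟨QuaternionAlgebra.swapEquiv _ _⟩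

theorem iso_of_anticommute (h2 : (2 : F) ≠ 0) {s t s' t' : F} (hs : s' ≠ 0) (ht : t' ≠ 0)
    (I J : ℍ[F,s,0,t]) (hI : I * I = algebraMap F _ s') (hJ : J * J = algebraMap F _ t')
    (hIJ : J * I = -(I * J)) : Iso s t s' t' := by
  obtain ⟨e, -⟩ := quaternionAlgebra_equiv_of_anticommute h2 hs ht
    (QuaternionAlgebra.finrank_eq_four _ _ _) I J hI hJ hIJ
  exact ⟨e.symm⟩

/-- The element `(x + y i) j` anticommutes with `i` and has square `t (x² - s y²)`. -/
theorem iso_mul_norm_right (h2 : (2 : F) ≠ 0) {s t t' : F} (hs : s ≠ 0) (ht' : t' ≠ 0) {x y : F}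
    (h : t' = t * (x ^ 2 - s * y ^ 2)) : Iso s t s t' := by
  refine iso_of_anticommute h2 hs ht' ⟨0, 1, 0, 0⟩ ⟨0, 0, x, y⟩ ?_ ?_ ?_
  · rw [QuaternionAlgebra.algebraMap_eq]; ext <;> simp
  · rw [QuaternionAlgebra.algebraMap_eq, h]; ext <;> simp <;> ring
  · ext <;> simp

theorem iso_mul_norm_left (h2 : (2 : F) ≠ 0) {s s' t : F} (ht : t ≠ 0) (hs' : s' ≠ 0) {x y : F}
    (h : s' = s * (x ^ 2 - t * y ^ 2)) : Iso s t s' t :=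
  (iso_swap s t).trans ((iso_mul_norm_right h2 ht hs' h).trans (iso_swap t s'))

theorem exists_sq_sub_sq (h2 : (2 : F) ≠ 0) (r : F) : ∃ x y : F, r = x ^ 2 - y ^ 2 :=
  ⟨(r + 1) / 2, (r - 1) / 2, by field_simp; ring⟩

/-- The quaternion algebra `(s, t)` is split if `t` is a norm from `F(√s)`. -/
theorem iso_one_one_of_isNorm (h2 : (2 : F) ≠ 0) {s t : F} (hs : s ≠ 0) (ht : t ≠ 0)
    (h : IsNorm s t) : Iso s t 1 1 := by
  obtain ⟨x, y, hxy⟩ := h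
  have h1 : Iso s t s 1 := by
    refine iso_mul_norm_right h2 hs one_ne_zero (x := x / t) (y := y / t) ?_
    have : (x / t) ^ 2 - s * (y / t) ^ 2 = t / t ^ 2 := by
      linear_combination -(1 / t ^ 2) * hxy
    rw [this]; field_simp
  obtain ⟨z, w, hzw⟩ := exists_sq_sub_sq h2 s⁻¹
  refine h1.trans (iso_mul_norm_left h2 one_ne_zero one_ne_zero (x := z) (y := w) ?_)
  rw [one_mul, ← hzw, mul_inv_cancel₀ hs]

theorem IsNorm.mul {s r r' : F} (h : IsNorm s r) (h' : IsNorm s r') : IsNorm s (r * r') := by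
  obtain ⟨x, y, rfl⟩ := h
  obtain ⟨z, w, rfl⟩ := h'
  exact ⟨x * z + s * y * w, x * w + y * z, by ring⟩

theorem IsNorm.mul_sq {s r : F} (h : IsNorm s r) (c : F) : IsNorm s (r * c ^ 2) :=
  h.mul ⟨c, 0, by ring⟩

theorem IsNorm.div {s r r' : F} (h : IsNorm s r) (h' : IsNorm s r') : IsNorm s (r / r') := by
  have := (h.mul h').mul_sq r'⁻¹
  by_cases hr : r' = 0
  · subst hr; exact ⟨0, 0, by simp⟩
  · convert this using 1; field_simp

theorem isNorm_of_isSquare (h2 : (2 : F) ≠ 0) {s : F} (hs : s ≠ 0) (h : IsSquare s) (r : F) :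
    IsNorm s r := by
  obtain ⟨c, rfl⟩ := h
  have hc : c ≠ 0 := by rintro rfl; simp at hs
  obtain ⟨x, y, rfl⟩ := exists_sq_sub_sq h2 r
  exact ⟨x, y / c, by field_simp⟩

/-- The reduced norm is `N(z) - t N(w)` with `N` the norm form of `F(√s)`, anisotropic because `s`
is not a square. A zero with `w ≠ 0` would give `t = N(z) / N(w)`. -/
theorem isDivision_of_not_isNorm (h2 : (2 : F) ≠ 0) {s t : F} (hs : s ≠ 0)
    (h : ¬ IsNorm s t) : IsDivision s t := by
  have hsq : ¬ IsSquare s := fun h' => h (isNorm_of_isSquare h2 hs h' t)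
  have anis : ∀ x y : F, x ^ 2 - s * y ^ 2 = 0 → x = 0 ∧ y = 0 := by
    intro x y hxy
    have hy : y = 0 := by
      by_contra hy
      exact hsq ⟨x / y, by field_simp; linear_combination -hxy⟩
    subst hy
    exact ⟨by simpa using hxy, rfl⟩
  rintro ⟨a, b, c, d⟩ h0
  simp only [nrd] at h0
  have hcd : c ^ 2 - s * d ^ 2 = 0 := by
    by_contra hne
    refine h ?_
    have := IsNorm.div (s := s) ⟨a, b, rfl⟩ ⟨c, d, rfl⟩
    convert this using 1
    rw [eq_div_iff hne]; linear_combination -h0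
  obtain ⟨rfl, rfl⟩ := anis c d hcd
  obtain ⟨rfl, rfl⟩ := anis a b (by linear_combination h0)
  rfl

theorem IsDivision.not_isNorm {s t : F} (h : IsDivision s t) : ¬ IsNorm s t := by
  rintro ⟨x, y, hxy⟩
  have := h ⟨x, y, 1, 0⟩ (by simp [nrd, hxy])
  have := congrArg QuaternionAlgebra.imJ this
  simp at this

theorem IsDivision.not_isSquare (h2 : (2 : F) ≠ 0) {s t : F} (hs : s ≠ 0) (h : IsDivision s t) :
    ¬ IsSquare s := fun h' => h.not_isNorm (isNorm_of_isSquare h2 hs h' t)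

/-- If `1` is the square of a pure quaternion, then the quaternion algebra is split. -/
theorem isNorm_of_represents_one (h2 : (2 : F) ≠ 0) {s t : F} (hs : s ≠ 0)
    (h : Represents s t 1) : IsNorm s t := by
  by_contra hn
  obtain ⟨a, b, c, habc⟩ := h
  -- If the pure quaternion `x` has square `1`, then `1 + x` has reduced norm `1 - 1 = 0`.
  have := isDivision_of_not_isNorm h2 hs hn ⟨1, a, b, c⟩
    (by simp only [nrd, pureSq] at *; linear_combination -habc)
  have := congrArg QuaternionAlgebra.re this
  simp at this

theorem represents_one_of_isNorm (h2 : (2 : F) ≠ 0) {s t : F} (ht : t ≠ 0)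
    (h : IsNorm s t) : Represents s t 1 := by
  obtain ⟨x, y, hxy⟩ := h
  -- With coordinates `(p, q x, q y)` the last two terms of the pure form collapse to `t² q²`, so a
  -- point on this conic suffices.
  obtain ⟨p, q, hpq⟩ : ∃ p q : F, s * p ^ 2 + t ^ 2 * q ^ 2 = 1 := by
    by_cases h1 : 1 + s = 0
    · obtain ⟨u, v, huv⟩ := exists_sq_sub_sq h2 (1 : F)
      refine ⟨v, u / t, ?_⟩
      field_simp
      linear_combination v ^ 2 * h1 - huv
    · exact ⟨2 / (1 + s), (1 - s) / (1 + s) / t, by field_simp; ring⟩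
  exact ⟨p, q * x, q * y, by simp only [pureSq]; linear_combination hpq - t * q ^ 2 * hxy⟩

/-- Isomorphic quaternion algebras have the same squares of pure quaternions. -/
theorem Iso.represents (h2 : (2 : F) ≠ 0) {s t s' t' r : F} (h : Iso s t s' t')
    (hrep : Represents s t r) : Represents s' t' r := by
  obtain ⟨e⟩ := h
  obtain ⟨a, b, c, habc⟩ := hrep
  let x : ℍ[F,s,0,t] := ⟨0, a, b, c⟩
  have hx : x * x = QuaternionAlgebra.coe r := by
    rw [← habc]
    ext <;> simp [x] <;> (try simp only [pureSq]) <;> ring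
  have hex : e x * e x = algebraMap F _ r := by
    rw [← map_mul, hx]; exact e.commutes r
  -- A quaternion with scalar square is pure or scalar; if `e x` were a scalar, then so would be the
  -- pure `x`.
  have hre : (e x).re = 0 := by
    by_contra hne
    have h1 := congrArg QuaternionAlgebra.imI hex
    have h2' := congrArg QuaternionAlgebra.imJ hex
    have h3 := congrArg QuaternionAlgebra.imK hex
    simp [QuaternionAlgebra.algebraMap_eq] at h1 h2' h3
    have g1 : (e x).imI = 0 := by
      have : 2 * (e x).re * (e x).imI = 0 := by linear_combination h1
      simpa [h2, hne] using this
    have g2 : (e x).imJ = 0 := by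
      have : 2 * (e x).re * (e x).imJ = 0 := by linear_combination h2'
      simpa [h2, hne] using this
    have g3 : (e x).imK = 0 := by
      have : 2 * (e x).re * (e x).imK = 0 := by linear_combination h3
      simpa [h2, hne] using this
    have hco : e x = algebraMap F _ (e x).re := by
      ext <;> simp [QuaternionAlgebra.algebraMap_eq, g1, g2, g3]
    have hxc : x = algebraMap F _ (e x).re := by
      apply e.injective
      rw [e.commutes]; exact hco
    have := congrArg QuaternionAlgebra.re hxc
    simp [QuaternionAlgebra.algebraMap_eq, x] at this
    exact hne this.symm
  refine ⟨(e x).imI, (e x).imJ, (e x).imK, ?_⟩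
  have h0 := congrArg QuaternionAlgebra.re hex
  simp [QuaternionAlgebra.algebraMap_eq, hre] at h0
  simp only [pureSq]
  linear_combination h0

/-- If `δ` is the square of a pure quaternion in two division algebras `(s, t₁)` and `(s, t₂)`, then
these algebras and `(s, t₁ t₂)` can be rewritten simultaneously with first slot `δ`. -/
theorem exists_common_slot (h2 : (2 : F) ≠ 0) {s t₁ t₂ δ : F} (hs : s ≠ 0) (ht₁ : t₁ ≠ 0)
    (ht₂ : t₂ ≠ 0) (hδ : δ ≠ 0) (hsq : ¬ IsSquare s) (h₁ : Represents s t₁ δ)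
    (h₂ : Represents s t₂ δ) :
    ∃ r₁ r₂ : F, r₁ ≠ 0 ∧ r₂ ≠ 0 ∧ Iso s t₁ δ r₁ ∧ Iso s t₂ δ r₂ ∧ Iso s (t₁ * t₂) δ (r₁ * r₂) := by
  -- Multiplying `δ = s a² + t b² - s t c²` by `s` gives `s δ = (s a)² - r` with `r = t ((s c)² - s
  -- b²)`, which is `t` times a norm from `F(√s)`.
  have key : ∀ t : F, t ≠ 0 → Represents s t δ → ∃ r x y A B : F, r ≠ 0 ∧
      r = t * (x ^ 2 - s * y ^ 2) ∧ s * δ = A ^ 2 - r * B ^ 2 := by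
    rintro t ht ⟨a, b, c, rfl⟩
    by_cases h0 : c = 0 ∧ b = 0
    · obtain ⟨rfl, rfl⟩ := h0
      exact ⟨t, 1, 0, s * a, 0, ht, by ring, by simp only [pureSq]; ring⟩
    · refine ⟨t * ((s * c) ^ 2 - s * b ^ 2), s * c, b, s * a, 1, mul_ne_zero ht ?_, rfl,
        by simp only [pureSq]; ring⟩
      intro h
      by_cases hb : b = 0
      · subst hb
        apply h0
        simpa [hs] using h
      · have hb' : b ^ 2 = s * c ^ 2 := mul_left_cancel₀ hs (by linear_combination -h)
        exact hsq ⟨s * c / b, by field_simp; linear_combination hb'⟩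
  obtain ⟨r₁, x₁, y₁, A₁, B₁, hr₁, hn₁, hN₁⟩ := key t₁ ht₁ h₁
  obtain ⟨r₂, x₂, y₂, A₂, B₂, hr₂, hn₂, hN₂⟩ := key t₂ ht₂ h₂
  have hsδ : s * δ ≠ 0 := mul_ne_zero hs hδ
  -- As `s δ` is a norm from `F(√r)`, so is `δ / s = s δ / s²`, and the first slot may be changed.
  have slot : ∀ r A B : F, r ≠ 0 → s * δ = A ^ 2 - r * B ^ 2 → Iso s r δ r := by
    intro r A B hr h
    refine iso_mul_norm_left h2 hr hδ (x := A / s) (y := B / s) ?_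
    field_simp
    linear_combination h
  -- Symmetry of the norm relation: `r₁` and `r₂` are norms from `F(√(s δ))`, so their product is
  -- one, and the relation is turned back. Vanishing denominators mean that `s δ` or `r₁ r₂` is a
  -- square.
  have hnorm : ∃ A B : F, s * δ = A ^ 2 - (r₁ * r₂) * B ^ 2 := by
    have flip : ∀ r A B : F, s * δ = A ^ 2 - r * B ^ 2 → B ≠ 0 → IsNorm (s * δ) r := by
      intro r A B h hB
      exact ⟨A / B, 1 / B, by field_simp; linear_combination h⟩
    by_cases hB₁ : B₁ = 0
    · subst hB₁; exact ⟨A₁, 0, by linear_combination hN₁⟩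
    by_cases hB₂ : B₂ = 0
    · subst hB₂; exact ⟨A₂, 0, by linear_combination hN₂⟩
    obtain ⟨C, D, hCD⟩ := (flip r₁ A₁ B₁ hN₁ hB₁).mul (flip r₂ A₂ B₂ hN₂ hB₂)
    by_cases hD : D = 0
    · subst hD
      have hC : C ≠ 0 := by
        rintro rfl
        exact mul_ne_zero hr₁ hr₂ (by linear_combination hCD)
      obtain ⟨x, y, hxy⟩ := exists_sq_sub_sq h2 (s * δ)
      exact ⟨x, y / C, by rw [hCD]; field_simp; linear_combination C ^ 2 * hxy⟩
    · exact ⟨C / D, 1 / D, by field_simp; linear_combination hCD⟩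
  obtain ⟨A, B, hAB⟩ := hnorm
  have hr := mul_ne_zero hr₁ hr₂
  refine ⟨r₁, r₂, hr₁, hr₂, ?_, ?_, ?_⟩
  · exact (iso_mul_norm_right h2 hs hr₁ hn₁).trans (slot r₁ A₁ B₁ hr₁ hN₁)
  · exact (iso_mul_norm_right h2 hs hr₂ hn₂).trans (slot r₂ A₂ B₂ hr₂ hN₂)
  · refine Iso.trans ?_ (slot _ A B hr hAB)
    refine iso_mul_norm_right h2 hs hr (x := x₁ * x₂ + s * y₁ * y₂) (y := x₁ * y₂ + y₁ * x₂) ?_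
    rw [hn₁, hn₂]; ring

end QuaternionPair

/-! ### Quaternion division algebras and their maximal subfields -/

section DivisionAlgebra

variable {F D : Type*} [Field F] [DivisionRing D] [Algebra F D]

/-- A noncentral square root of a central element of a quaternion division algebra can be
completed to a quaternion basis. -/
theorem exists_quaternion_basis_of_sq [Algebra.IsCentral F D] (h2 : (2 : F) ≠ 0)
    (hD : Module.finrank F D = 4) {y : D} {s : F} (hy : y * y = algebraMap F D s)
    (hyF : y ∉ Set.range (algebraMap F D)) :
    ∃ t : F, t ≠ 0 ∧ ∃ e : ℍ[F,s,0,t] ≃ₐ[F] D, e ⟨0, 1, 0, 0⟩ = y := by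
  have hfin : FiniteDimensional F D := .of_finrank_pos (by omega)
  have hy0 : y ≠ 0 := by rintro rfl; exact hyF ⟨0, by simp⟩
  have hs : s ≠ 0 := by
    rintro rfl
    rw [map_zero] at hy
    exact hy0 (by simpa using hy)
  have hcen : ∀ z : D, (∀ w, w * z = z * w) → ∃ r : F, algebraMap F D r = z := by
    intro z hz
    have : z ∈ Subalgebra.center F D := by
      rw [Subalgebra.mem_center_iff]; exact hz
    rw [Algebra.IsCentral.center_eq_bot] at this
    exact Algebra.mem_bot.1 this
  obtain ⟨d, hd⟩ : ∃ d : D, d * y ≠ y * d := by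
    by_contra! h
    exact hyF (hcen y h)
  have hyyd : ∀ d : D, y * (y * d) = d * (y * y) := by
    intro d
    rw [← mul_assoc, hy, Algebra.commutes]
  -- Since `y²` is central, a commutator with `y` anticommutes with `y`. Then `j²` commutes with `y`
  -- and `j`, hence with everything once `1, y, j, y j` span.
  set j : D := d * y - y * d with hj
  have hj0 : j ≠ 0 := sub_ne_zero.2 hd
  have hjy : j * y = -(y * j) := by
    rw [hj, sub_mul, mul_sub, hyyd, mul_assoc, mul_assoc]; abel
  have hjjy : (j * j) * y = y * (j * j) := by
    rw [mul_assoc, hjy, mul_neg, ← mul_assoc, hjy, neg_mul, neg_neg, mul_assoc]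
  -- `1, y, j, y j` span `D`
  have hlin : LinearIndependent F ![(1 : D), y, j, y * j] := by
    rw [Fintype.linearIndependent_iff]
    intro g hg
    simp only [Fin.sum_univ_four, Matrix.cons_val] at hg
    have hp : ∀ a b : F, a • (1 : D) + b • y = 0 → a = 0 ∧ b = 0 := by
      intro a b hab
      have hb : b = 0 := by
        by_contra hb
        refine hyF ⟨-a / b, ?_⟩
        have : b • y = (-a) • (1 : D) := by linear_combination (norm := module) hab
        rw [Algebra.algebraMap_eq_smul_one, div_eq_inv_mul, mul_smul, ← this, smul_smul,
          inv_mul_cancel₀ hb, one_smul]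
      subst hb
      refine ⟨?_, rfl⟩
      have : a • (1 : D) = 0 := by simpa using hab
      simpa using this
    have e1 := congrArg (fun z => z * y) hg
    have e2 := congrArg (fun z => y * z) hg
    simp only [mul_add, add_mul, mul_smul_comm, smul_mul_assoc, mul_one, one_mul, mul_zero,
      zero_mul, mul_assoc, hjy, mul_neg] at e1 e2
    have e3 : y * (g 0 • (1 : D) + g 1 • y) = 0 := by
      have h : (2 : F) • (y * (g 0 • (1 : D) + g 1 • y)) = 0 := by
        simp only [mul_add, mul_smul_comm, mul_one]
        linear_combination (norm := module) e1 + e2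
      exact (smul_eq_zero.1 h).resolve_left h2
    obtain ⟨h0, h1⟩ := hp _ _ ((mul_eq_zero.1 e3).resolve_left hy0)
    have e4 : (g 2 • (1 : D) + g 3 • y) * j = 0 := by
      rw [h0, h1] at hg
      simp only [add_mul, smul_mul_assoc, one_mul]
      linear_combination (norm := module) hg
    obtain ⟨h2', h3⟩ := hp _ _ ((mul_eq_zero.1 e4).resolve_right hj0)
    intro i
    fin_cases i <;> assumption
  have hspan : Submodule.span F (Set.range ![(1 : D), y, j, y * j]) = ⊤ :=
    hlin.span_eq_top_of_card_eq_finrank' (by simp [hD])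
  obtain ⟨t, ht⟩ : ∃ t : F, algebraMap F D t = j * j := by
    apply hcen
    intro w
    have hw : w ∈ Submodule.span F (Set.range ![(1 : D), y, j, y * j]) := by
      rw [hspan]; trivial
    induction hw using Submodule.span_induction with
    | mem x hx =>
      obtain ⟨i, rfl⟩ := hx
      fin_cases i
      · simp
      · simpa using hjjy.symm
      · simp [mul_assoc]
      · change y * j * (j * j) = j * j * (y * j)
        rw [← mul_assoc (j * j), hjjy, mul_assoc, mul_assoc, mul_assoc]
    | zero => simp
    | add x z _ _ hx hz => rw [add_mul, mul_add, hx, hz]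
    | smul a x _ hx => rw [smul_mul_assoc, mul_smul_comm, hx]
  have ht0 : t ≠ 0 := by
    rintro rfl
    rw [map_zero] at ht
    exact hj0 (by simpa using ht.symm)
  obtain ⟨e, he, -⟩ := quaternionAlgebra_equiv_of_anticommute h2 hs ht0 hD y j hy ht.symm hjy
  exact ⟨t, ht0, e, he⟩

/-- A quaternion division algebra contains a noncentral square root of a central element. -/
theorem exists_noncentral_sq [Algebra.IsCentral F D] (h2 : (2 : F) ≠ 0)
    (hD : Module.finrank F D = 4) :
    ∃ (y : D) (s : F), y * y = algebraMap F D s ∧ y ∉ Set.range (algebraMap F D) := by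
  have hfin : FiniteDimensional F D := .of_finrank_pos (by omega)
  obtain ⟨x, hx⟩ : ∃ x : D, x ∉ Set.range (algebraMap F D) := by
    by_contra! h
    have hle : (⊤ : Submodule F D) ≤ Submodule.span F {1} := by
      intro z _
      obtain ⟨r, rfl⟩ := h z
      rw [Algebra.algebraMap_eq_smul_one]
      exact Submodule.smul_mem _ _ (Submodule.mem_span_singleton_self 1)
    have h1 := Submodule.finrank_mono hle
    rw [finrank_top, hD] at h1
    have := finrank_span_singleton (K := F) (one_ne_zero (α := D))
    omega
  let S := Algebra.adjoin F {x}
  have hxS : x ∈ S := Algebra.self_mem_adjoin_singleton F x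
  let _ : DivisionRing S := divisionRingOfFiniteDimensional F S
  -- The degree of `F[x]` divides `4`; it is not `1` as `x` is not a scalar, nor `4` as `D` is not
  -- commutative.
  have hmul : Module.finrank F S * Module.finrank S D = 4 := by
    rw [Module.finrank_mul_finrank, hD]
  have hli : LinearIndependent F ![(1 : S), ⟨x, hxS⟩] := by
    rw [LinearIndependent.pair_iff]
    intro a b hab
    have hab' : a • (1 : D) + b • x = 0 := congrArg Subtype.val hab
    have hb : b = 0 := by
      by_contra hb
      refine hx ⟨-a / b, ?_⟩
      have : b • x = (-a) • (1 : D) := by linear_combination (norm := module) hab'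
      rw [Algebra.algebraMap_eq_smul_one, div_eq_inv_mul, mul_smul, ← this, smul_smul,
        inv_mul_cancel₀ hb, one_smul]
    subst hb
    exact ⟨by simpa using hab', rfl⟩
  have hge : 2 ≤ Module.finrank F S := by simpa using hli.fintype_card_le_finrank
  have hne : Module.finrank F S ≠ 4 := by
    intro h4
    have htop : S = ⊤ := by
      apply Subalgebra.toSubmodule_injective
      exact Submodule.eq_top_of_finrank_eq (by rw [hD]; exact h4)
    have hcomm : ∀ z w : D, z * w = w * z := by
      intro z w
      have hz : z ∈ S := by rw [htop]; trivial
      have hw : w ∈ S := by rw [htop]; trivial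
      exact congrArg Subtype.val (mul_comm' (⟨z, hz⟩ : S) ⟨w, hw⟩)
    have hx' : x ∈ Subalgebra.center F D := by
      rw [Subalgebra.mem_center_iff]; exact fun w => hcomm w x
    rw [Algebra.IsCentral.center_eq_bot] at hx'
    exact hx (Algebra.mem_bot.1 hx')
  have hd : Module.finrank F S = 2 := by
    have hdvd : Module.finrank F S ∣ 4 := ⟨_, hmul.symm⟩
    have hle := Nat.le_of_dvd (by norm_num) hdvd
    interval_cases hf : Module.finrank F S <;> omega
  have hspan := hli.span_eq_top_of_card_eq_finrank' (by simp [hd])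
  have hmem : (⟨x, hxS⟩ * ⟨x, hxS⟩ : S) ∈ Submodule.span F (Set.range ![(1 : S), ⟨x, hxS⟩]) := by
    rw [hspan]; trivial
  rw [Matrix.range_cons_cons_empty, Submodule.mem_span_pair] at hmem
  obtain ⟨b, a, hab⟩ := hmem
  have hab' : b • (1 : D) + a • x = x * x := congrArg Subtype.val hab
  -- Completing the square in `x² = a x + b`.
  refine ⟨x - (a / 2) • (1 : D), b + a ^ 2 / 4, ?_, ?_⟩
  · have h4 : (4 : F) ≠ 0 := by
      have : (4 : F) = 2 * 2 := by norm_num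
      rw [this]; exact mul_ne_zero h2 h2
    rw [Algebra.algebraMap_eq_smul_one]
    simp only [sub_mul, mul_sub, smul_mul_assoc, mul_smul_comm, one_mul, mul_one, ← hab']
    match_scalars <;> field_simp <;> ring
  · rintro ⟨r, hr⟩
    refine hx ⟨r + a / 2, ?_⟩
    rw [map_add, hr, Algebra.algebraMap_eq_smul_one (a / 2)]
    abel

theorem commute_iff_of_quaternion_basis (h2 : (2 : F) ≠ 0) {s t : F} (hs : s ≠ 0)
    (z : ℍ[F,s,0,t]) :
    z * ⟨0, 1, 0, 0⟩ = ⟨0, 1, 0, 0⟩ * z ↔ z.imJ = 0 ∧ z.imK = 0 := by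
  constructor
  · intro h
    have hJ := congrArg QuaternionAlgebra.imJ h
    have hK := congrArg QuaternionAlgebra.imK h
    simp at hJ hK
    constructor
    · have : 2 * z.imJ = 0 := by linear_combination -hK
      simpa [h2] using this
    · have : 2 * s * z.imK = 0 := by linear_combination -hJ
      simpa [h2, hs] using this
  · rintro ⟨hJ, hK⟩
    ext <;> simp [hJ, hK, mul_comm]

/-- A noncentral square root of a central element of a quaternion division algebra lies in a
maximal subfield. -/
theorem exists_isMaximalSubfield [Algebra.IsCentral F D] (h2 : (2 : F) ≠ 0)
    (hD : Module.finrank F D = 4) {y : D} {s : F} (hy : y * y = algebraMap F D s)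
    (hyF : y ∉ Set.range (algebraMap F D)) :
    ∃ K : Subalgebra F D, IsMaximalSubfield K ∧ y ∈ K := by
  obtain ⟨t, ht, e, he⟩ := exists_quaternion_basis_of_sq h2 hD hy hyF
  have hs : s ≠ 0 := by
    rintro rfl
    rw [map_zero] at hy
    exact hyF ⟨0, by rw [map_zero, show y = 0 by simpa using hy]⟩
  have hmem : ∀ z : D, z ∈ Subalgebra.centralizer F {y} ↔ z * y = y * z := by
    intro z
    rw [Subalgebra.mem_centralizer_iff]
    simp [eq_comm]
  -- The centralizer of `y` is `F + F y`: it is commutative, and it contains every commutative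
  -- subring through `y`.
  have hform : ∀ z ∈ Subalgebra.centralizer F {y}, ∃ a b : F, z = a • 1 + b • y := by
    intro z hz
    rw [hmem] at hz
    have h1 : e.symm z * ⟨0, 1, 0, 0⟩ = ⟨0, 1, 0, 0⟩ * e.symm z := by
      apply e.injective
      rw [map_mul, map_mul, he, e.apply_symm_apply, hz]
    rw [commute_iff_of_quaternion_basis h2 hs] at h1
    refine ⟨(e.symm z).re, (e.symm z).imI, ?_⟩
    apply e.symm.injective
    rw [map_add, map_smul, map_smul, map_one, ← he, e.symm_apply_apply]
    ext <;> simp [h1.1, h1.2]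
  refine ⟨Subalgebra.centralizer F {y}, ⟨?_, ?_⟩, (hmem y).2 rfl⟩
  · refine ⟨⟨0, 1, zero_ne_one⟩, ?_, ?_⟩
    · rintro ⟨u, hu⟩ ⟨w, hw⟩
      obtain ⟨a, b, rfl⟩ := hform u hu
      rw [hmem] at hw
      ext
      simp [add_mul, mul_add, hw]
    · rintro ⟨u, hu⟩ hu0
      have hu0' : u ≠ 0 := fun h => hu0 (Subtype.ext h)
      refine ⟨⟨u⁻¹, ?_⟩, Subtype.ext (mul_inv_cancel₀ hu0')⟩
      rw [hmem] at hu ⊢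
      rw [inv_mul_eq_iff_eq_mul₀ hu0', ← mul_assoc, hu, mul_assoc, mul_inv_cancel₀ hu0', mul_one]
  · intro S hS hle z hz
    rw [hmem]
    have hyS : y ∈ S := hle ((hmem y).2 rfl)
    have := hS.mul_comm ⟨z, hz⟩ ⟨y, hyS⟩
    exact congrArg Subtype.val this

end DivisionAlgebra

/-- The elements of `F` with a noncentral square root in `D₁` have one in `D₂` if every maximal
subfield of `D₁` is isomorphic to a maximal subfield of `D₂`. -/
theorem exists_sq_of_maximalSubfields {F D₁ D₂ : Type*} [Field F] [DivisionRing D₁] [Algebra F D₁]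
    [DivisionRing D₂] [Algebra F D₂] [Algebra.IsCentral F D₁] (h2 : (2 : F) ≠ 0)
    (hD : Module.finrank F D₁ = 4)
    (h : ∀ K₁ : Subalgebra F D₁, IsMaximalSubfield K₁ →
      ∃ K₂ : Subalgebra F D₂, IsMaximalSubfield K₂ ∧ Nonempty (K₁ ≃ₐ[F] K₂))
    {y : D₁} {s : F} (hy : y * y = algebraMap F D₁ s) (hyF : y ∉ Set.range (algebraMap F D₁)) :
    ∃ x : D₂, x * x = algebraMap F D₂ s ∧ x ∉ Set.range (algebraMap F D₂) := by
  obtain ⟨K, hK, hyK⟩ := exists_isMaximalSubfield h2 hD hy hyF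
  obtain ⟨K₂, -, ⟨φ⟩⟩ := h K hK
  refine ⟨φ ⟨y, hyK⟩, ?_, ?_⟩
  · have : (⟨y, hyK⟩ : K) * ⟨y, hyK⟩ = algebraMap F K s := Subtype.ext hy
    have h' := congrArg φ this
    rw [map_mul, φ.commutes] at h'
    exact congrArg Subtype.val h'
  · rintro ⟨r, hr⟩
    have h' : φ ⟨y, hyK⟩ = φ (algebraMap F K r) := by
      rw [φ.commutes]; exact Subtype.ext hr.symm
    exact hyF ⟨r, (congrArg Subtype.val (φ.injective h')).symm⟩

/-! ### Splitting of quaternion algebras -/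

namespace QuaternionPair

variable {F : Type*} [Field F]

theorem matrix_equiv (h2 : (2 : F) ≠ 0) :
    Nonempty (ℍ[F,1,0,1] ≃ₐ[F] Matrix (Fin 2) (Fin 2) F) := by
  obtain ⟨e, -⟩ := quaternionAlgebra_equiv_of_anticommute (A := Matrix (Fin 2) (Fin 2) F) h2
    one_ne_zero one_ne_zero (by simp [Module.finrank_matrix]) !![1, 0; 0, -1] !![0, 1; 1, 0]
    (by ext i j; fin_cases i <;> fin_cases j <;> simp)
    (by ext i j; fin_cases i <;> fin_cases j <;> simp)
    (by ext i j; fin_cases i <;> fin_cases j <;> simp)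
  exact ⟨e⟩

/-- Base change of a quaternion algebra. -/
theorem baseChange_equiv (h2 : (2 : F) ≠ 0) (E : Type*) [Field E] [Algebra F E] {s t : F}
    (hs : s ≠ 0) (ht : t ≠ 0) :
    Nonempty (E ⊗[F] ℍ[F,s,0,t] ≃ₐ[E] ℍ[E,algebraMap F E s,0,algebraMap F E t]) := by
  have hinj := (algebraMap F E).injective
  have h2E : (2 : E) ≠ 0 := by
    intro h
    apply h2
    apply hinj
    rw [map_ofNat, map_zero, h]
  have halg : ∀ r : F, (1 : E) ⊗ₜ[F] (algebraMap F ℍ[F,s,0,t] r) =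
      algebraMap E (E ⊗[F] ℍ[F,s,0,t]) (algebraMap F E r) := by
    intro r
    rw [Algebra.TensorProduct.algebraMap_apply, Algebra.algebraMap_self, RingHom.id_apply,
      Algebra.algebraMap_eq_smul_one, Algebra.algebraMap_eq_smul_one, TensorProduct.smul_tmul]
  obtain ⟨e, -⟩ := quaternionAlgebra_equiv_of_anticommute (A := E ⊗[F] ℍ[F,s,0,t]) h2E
    ((map_ne_zero _).2 hs) ((map_ne_zero _).2 ht)
    (by rw [Module.finrank_baseChange, QuaternionAlgebra.finrank_eq_four])
    (1 ⊗ₜ ⟨0, 1, 0, 0⟩) (1 ⊗ₜ ⟨0, 0, 1, 0⟩)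
    (by
      rw [Algebra.TensorProduct.tmul_mul_tmul, one_mul, ← halg]
      congr 1
      rw [QuaternionAlgebra.algebraMap_eq]
      ext <;> simp)
    (by
      rw [Algebra.TensorProduct.tmul_mul_tmul, one_mul, ← halg]
      congr 1
      rw [QuaternionAlgebra.algebraMap_eq]
      ext <;> simp)
    (by
      rw [Algebra.TensorProduct.tmul_mul_tmul, Algebra.TensorProduct.tmul_mul_tmul, one_mul,
        ← TensorProduct.tmul_neg]
      congr 1
      ext <;> simp)
  exact ⟨e.symm⟩

theorem isCentral (h2 : (2 : F) ≠ 0) {s t : F} (hs : s ≠ 0) :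
    Algebra.IsCentral F ℍ[F,s,0,t] := by
  constructor
  intro z hz
  rw [Subalgebra.mem_center_iff] at hz
  have h1 := (commute_iff_of_quaternion_basis h2 hs z).1 (hz ⟨0, 1, 0, 0⟩).symm
  have h3 := congrArg QuaternionAlgebra.imK (hz ⟨0, 0, 1, 0⟩)
  simp at h3
  have h4 : z.imI = 0 := by
    have : 2 * z.imI = 0 := by linear_combination -h3
    simpa [h2] using this
  rw [Algebra.mem_bot]
  refine ⟨z.re, ?_⟩
  rw [QuaternionAlgebra.algebraMap_eq]
  ext <;> simp [h1.1, h1.2, h4]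

/-- The tensor square of a quaternion algebra is split. -/
theorem isSplitAlgebra_tensor_self (h2 : (2 : F) ≠ 0) {s t : F} (hs : s ≠ 0) (ht : t ≠ 0) :
    IsSplitAlgebra F (ℍ[F,s,0,t] ⊗[F] ℍ[F,s,0,t]) := by
  have h4 : (4 : F) ≠ 0 := by
    have : (4 : F) = 2 * 2 := by norm_num
    rw [this]; exact mul_ne_zero h2 h2
  let i : ℍ[F,s,0,t] := ⟨0, 1, 0, 0⟩
  let j : ℍ[F,s,0,t] := ⟨0, 0, 1, 0⟩
  let k : ℍ[F,s,0,t] := ⟨0, 0, 0, 1⟩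
  let f := AlgHom.mulLeftRight F ℍ[F,s,0,t]
  -- the projection to the scalars, and the coordinates
  let τ : ℍ[F,s,0,t] ⊗[F] (ℍ[F,s,0,t])ᵐᵒᵖ := (4 : F)⁻¹ • (1 ⊗ₜ 1 + s⁻¹ • i ⊗ₜ .op i + t⁻¹ • j ⊗ₜ .op j -
    (s * t)⁻¹ • k ⊗ₜ .op k)
  have hτ : ∀ x : ℍ[F,s,0,t], f τ x = QuaternionAlgebra.coe x.re := by
    intro x
    simp only [τ, f, map_smul, map_add, map_sub, LinearMap.smul_apply, LinearMap.add_apply,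
      LinearMap.sub_apply, AlgHom.mulLeftRight_apply, MulOpposite.unop_op, MulOpposite.unop_one]
    ext <;> simp [i, j, k] <;> field_simp <;> ring_nf <;> simp
  have hsurj : Function.Surjective f := by
    intro g
    -- The scalar parts of `x`, `i x`, `j x`, `k x` are, up to the factors `1, s, t, -st`, the
    -- coordinates of `x`; so `g` is rebuilt from its values on the basis.
    refine ⟨(g 1 ⊗ₜ 1) * τ + s⁻¹ • ((g i ⊗ₜ 1) * τ * (i ⊗ₜ 1)) +
      t⁻¹ • ((g j ⊗ₜ 1) * τ * (j ⊗ₜ 1)) - (s * t)⁻¹ • ((g k ⊗ₜ 1) * τ * (k ⊗ₜ 1)), ?_⟩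
    ext1 x
    have hx : x = x.re • (1 : ℍ[F,s,0,t]) + x.imI • i + x.imJ • j + x.imK • k := by
      ext <;> simp [i, j, k]
    have hgx : g x = x.re • g 1 + x.imI • g i + x.imJ • g j + x.imK • g k := by
      conv_lhs => rw [hx]
      simp only [map_add, map_smul]
    simp only [map_smul, map_add, map_sub, map_mul, LinearMap.smul_apply, LinearMap.add_apply,
      LinearMap.sub_apply, Module.End.mul_apply, hτ]
    simp only [f, AlgHom.mulLeftRight_apply, MulOpposite.unop_one, mul_one]
    rw [hgx]
    have e1 : (i * x).re = s * x.imI := by simp [i]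
    have e2 : (j * x).re = t * x.imJ := by simp [j]
    have e3 : (k * x).re = -(s * t * x.imK) := by simp [k]
    rw [e1, e2, e3]
    simp only [QuaternionAlgebra.mul_coe_eq_smul, smul_smul]
    match_scalars <;> field_simp
  have hop : Module.finrank F (ℍ[F,s,0,t])ᵐᵒᵖ = 4 := by
    rw [← (MulOpposite.opLinearEquiv F : ℍ[F,s,0,t] ≃ₗ[F] (ℍ[F,s,0,t])ᵐᵒᵖ).finrank_eq,
      QuaternionAlgebra.finrank_eq_four]
  have hfin : FiniteDimensional F (ℍ[F,s,0,t])ᵐᵒᵖ := .of_finrank_pos (by omega)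
  have hD : Module.finrank F ℍ[F,s,0,t] = 4 := QuaternionAlgebra.finrank_eq_four _ _ _
  have hbij : Function.Bijective f := by
    refine ⟨?_, hsurj⟩
    refine (LinearMap.injective_iff_surjective_of_finrank_eq_finrank
      (f := f.toLinearMap) ?_).2 hsurj
    rw [Module.finrank_tensorProduct, Module.finrank_linearMap, hop, hD]
  refine ⟨4, by norm_num, ⟨((Algebra.TensorProduct.congr AlgEquiv.refl
    QuaternionAlgebra.starAe).trans (AlgEquiv.ofBijective f hbij)).trans
    (algEquivMatrix (QuaternionAlgebra.basisOneIJK s 0 t))⟩⟩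

/-- A division ring structure on a quaternion algebra with anisotropic norm form. -/
noncomputable abbrev divisionRing {s t : F} (h : IsDivision s t) : DivisionRing ℍ[F,s,0,t] :=
  DivisionRing.ofIsUnitOrEqZero fun x => by
    by_cases hx : x = 0
    · exact Or.inr hx
    · left
      have hn : nrd x ≠ 0 := fun h0 => hx (h x h0)
      refine ⟨⟨x, (nrd x)⁻¹ • star x, ?_, ?_⟩, rfl⟩
      · rw [mul_smul_comm, self_mul_star, ← QuaternionAlgebra.coe_smul, smul_eq_mul,
          inv_mul_cancel₀ hn, QuaternionAlgebra.coe_one]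
      · rw [smul_mul_assoc, star_mul_self, ← QuaternionAlgebra.coe_smul, smul_eq_mul,
          inv_mul_cancel₀ hn, QuaternionAlgebra.coe_one]

/-- In terms of a quaternion algebra, `r` is the square of a noncentral element if and only if it
is represented by the pure part. -/
theorem represents_of_equiv (h2 : (2 : F) ≠ 0) {s t r : F} {D : Type*} [DivisionRing D]
    [Algebra F D] (e : ℍ[F,s,0,t] ≃ₐ[F] D) {x : D} (hx : x * x = algebraMap F D r)
    (hxF : x ∉ Set.range (algebraMap F D)) : Represents s t r := by
  set z := e.symm x with hz
  have hzz : z * z = QuaternionAlgebra.coe r := by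
    rw [hz, ← map_mul, hx, e.symm.commutes]; rfl
  have hne : z ≠ QuaternionAlgebra.coe z.re := by
    intro h
    refine hxF ⟨z.re, ?_⟩
    rw [← e.commutes, QuaternionAlgebra.algebraMap_eq]
    have : e z = x := by rw [hz, e.apply_symm_apply]
    rw [← this]
    exact congrArg e h.symm
  have h0 := congrArg QuaternionAlgebra.re hzz
  have h1 := congrArg QuaternionAlgebra.imI hzz
  have h3 := congrArg QuaternionAlgebra.imJ hzz
  have h4 := congrArg QuaternionAlgebra.imK hzz
  simp at h0 h1 h3 h4
  have hre : z.re = 0 := by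
    by_contra hre
    apply hne
    have g1 : 2 * z.re * z.imI = 0 := by linear_combination h1
    have g2 : 2 * z.re * z.imJ = 0 := by linear_combination h3
    have g3 : 2 * z.re * z.imK = 0 := by linear_combination h4
    have g1' : z.imI = 0 := by simpa [h2, hre] using g1
    have g2' : z.imJ = 0 := by simpa [h2, hre] using g2
    have g3' : z.imK = 0 := by simpa [h2, hre] using g3
    ext <;> simp [g1', g2', g3']
  exact ⟨z.imI, z.imJ, z.imK, by simp only [pureSq]; rw [hre] at h0; linear_combination h0⟩

theorem exists_sq_of_represents {s t r : F} (hr : r ≠ 0) {D : Type*} [DivisionRing D]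
    [Algebra F D] (e : ℍ[F,s,0,t] ≃ₐ[F] D) (h : Represents s t r) :
    ∃ x : D, x * x = algebraMap F D r ∧ x ∉ Set.range (algebraMap F D) := by
  obtain ⟨a, b, c, habc⟩ := h
  let z : ℍ[F,s,0,t] := ⟨0, a, b, c⟩
  have hz : z * z = QuaternionAlgebra.coe r := by
    rw [← habc]
    ext <;> simp [z] <;> (try simp only [pureSq]) <;> ring
  refine ⟨e z, ?_, ?_⟩
  · rw [← map_mul, hz, ← e.commutes]; rfl
  · rintro ⟨q, hq⟩
    rw [← e.commutes] at hq
    have h0 := congrArg QuaternionAlgebra.re (e.injective hq)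
    simp [QuaternionAlgebra.algebraMap_eq, z] at h0
    subst h0
    rw [map_zero] at hq
    have h1 := e.injective hq
    rw [← h1, mul_zero] at hz
    exact hr (by simpa using (congrArg QuaternionAlgebra.re hz).symm)

end QuaternionPair

/-! ### Quaternion algebras over henselian discretely valued fields -/

theorem WithZero.isSquare_iff_even_log {x : ℤᵐ⁰} (hx : x ≠ 0) : IsSquare x ↔ Even (log x) := by
  constructor
  · rintro ⟨y, rfl⟩
    have hy : y ≠ 0 := by rintro rfl; simp at hx
    rw [log_mul hy hy]
    exact ⟨_, rfl⟩
  · rintro ⟨n, hn⟩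
    exact ⟨exp n, by rw [← exp_add, ← hn, exp_log hx]⟩

theorem WithZero.isSquare_mul_of_not {x y : ℤᵐ⁰} (hx : ¬ IsSquare x) (hy : ¬ IsSquare y) :
    IsSquare (x * y) := by
  have hx0 : x ≠ 0 := by rintro rfl; exact hx ⟨0, by simp⟩
  have hy0 : y ≠ 0 := by rintro rfl; exact hy ⟨0, by simp⟩
  rw [isSquare_iff_even_log hx0, Int.not_even_iff_odd] at hx
  rw [isSquare_iff_even_log hy0, Int.not_even_iff_odd] at hy
  rw [isSquare_iff_even_log (mul_ne_zero hx0 hy0), log_mul hx0 hy0]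
  exact hx.add_odd hy

namespace Valuation

variable {E : Type*} [Field E] (v : Valuation E ℤᵐ⁰)

/-- The instance of Hensel's lemma for quadratic polynomials which reduce to `X (X - 1)`. -/
def QuadraticHensel : Prop := ∀ c : E, v c < 1 → ∃ y : E, v y < 1 ∧ y ^ 2 - y + c = 0

/-- The polynomial `X ^ 2 - a X + b` has integral coefficients, and its reduction has no root in the
residue field. -/
structure NoResidualRoot (a b : E) : Prop where
  val_a_le : v a ≤ 1
  val_b_le : v b ≤ 1
  val_eq_one : ∀ y : E, v y ≤ 1 → v (y ^ 2 - a * y + b) = 1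

variable {v}

theorem val_two_le : v 2 ≤ 1 := by
  have := v.map_add 1 1
  rw [one_add_one_eq_two] at this
  simpa using this

theorem NoResidualRoot.val_b {a b : E} (h : v.NoResidualRoot a b) : v b = 1 := by
  simpa using h.val_eq_one 0 (by simp)

/-- This is the norm form of `α + β ξ` for a root `ξ` of `X² - aX + b`. Without a residual root no
cancellation occurs, and its value is the square of `max (v α) (v β)`. -/
theorem NoResidualRoot.isSquare_val {a b : E} (h : v.NoResidualRoot a b) (α β : E) :
    IsSquare (v (α ^ 2 + a * α * β + b * β ^ 2)) := by
  by_cases hβ : β = 0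
  · subst hβ
    exact ⟨v α, by simp [sq]⟩
  have hβ' : v β ≠ 0 := (v.ne_zero_iff).2 hβ
  rcases le_or_gt (v α) (v β) with hle | hlt
  · have h1 := h.val_eq_one (-α / β) (by
      rw [map_div₀, v.map_neg]; exact (div_le_one₀ (zero_lt_iff.2 hβ')).2 hle)
    refine ⟨v β, ?_⟩
    have : α ^ 2 + a * α * β + b * β ^ 2 = ((-α / β) ^ 2 - a * (-α / β) + b) * β * β := by
      field_simp; ring
    rw [this, map_mul, map_mul, h1, one_mul]
  · refine ⟨v α, ?_⟩
    have hα' : v α ≠ 0 := fun h0 => by simp [h0] at hlt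
    have : α ^ 2 + a * α * β + b * β ^ 2 = α ^ 2 + (a * α * β + b * β ^ 2) := by ring
    rw [this, v.map_add_eq_of_lt_left, map_pow, sq]
    have hαβ : v α * v β < v α ^ 2 := by
      rw [sq]; exact mul_lt_mul_of_pos_left hlt (zero_lt_iff.2 hα')
    refine v.map_add_lt ?_ ?_
    · rw [map_mul, map_mul, map_pow]
      refine lt_of_le_of_lt ?_ hαβ
      rw [mul_assoc]
      exact mul_le_of_le_one_left' h.val_a_le
    · rw [map_mul, map_pow, map_pow]
      refine lt_of_le_of_lt (mul_le_of_le_one_left' h.val_b_le) ?_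
      refine lt_of_le_of_lt ?_ hαβ
      rw [sq]
      exact mul_le_mul_left hlt.le _

theorem NoResidualRoot.isSquare_val_norm {a b : E} (h : v.NoResidualRoot a b) (x y : E) :
    IsSquare (v (x ^ 2 - (a ^ 2 - 4 * b) * y ^ 2)) := by
  -- With `ξ = (a + √δ)/2` one has `x + y √δ = (x - a y) + 2 y ξ`.
  have := h.isSquare_val (x - a * y) (2 * y)
  convert this using 2
  ring

/-- If the discriminant vanished, the double root `a / 2` would be integral, its square `b` being
so. -/
theorem NoResidualRoot.disc_ne_zero {a b : E} (h2 : (2 : E) ≠ 0) (h : v.NoResidualRoot a b) :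
    a ^ 2 - 4 * b ≠ 0 := by
  intro h0
  have hb : b = (a / 2) ^ 2 := by
    have h4 : (4 : E) ≠ 0 := by
      have : (4 : E) = 2 * 2 := by norm_num
      rw [this]; exact mul_ne_zero h2 h2
    field_simp
    linear_combination -h0
  have hv : v (a / 2) ≤ 1 := by
    have := h.val_b_le
    rw [hb, map_pow] at this
    exact (pow_le_one_iff (by norm_num)).1 this
  have := h.val_eq_one _ hv
  rw [show (a / 2) ^ 2 - a * (a / 2) + b = 0 by rw [hb]; field_simp; ring] at this
  simp at this

open QuaternionPair

/-- In an unramified quadratic extension every principal unit is a norm. If `a` is a unit, `1 - (a y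
/ b) ξ` with `ξ = (a + √δ)/2` has norm `1 + a² (y² - y) / b`, and Hensel's lemma provides `y`. If
not, `v δ = 1` makes `2` a unit and `1 + m` is the square of some `1 - 2 y`. -/
theorem NoResidualRoot.isNorm_one_add {a b m : E} (h2 : (2 : E) ≠ 0) (hH : v.QuadraticHensel)
    (h : v.NoResidualRoot a b) (hδ : v (a ^ 2 - 4 * b) = 1) (hm : v m < 1) :
    IsNorm (a ^ 2 - 4 * b) (1 + m) := by
  have h4 : (4 : E) = 2 * 2 := by norm_num
  by_cases ha : v a = 1
  · have ha0 : a ≠ 0 := by rintro rfl; simp at ha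
    have hb0 : b ≠ 0 := by intro hb; simpa [hb] using h.val_b
    obtain ⟨y, -, hy⟩ := hH (-(m * b / a ^ 2)) (by
      rw [v.map_neg, map_div₀, map_mul, map_pow, ha, h.val_b]; simpa using hm)
    refine ⟨1 - a ^ 2 * y / (2 * b), -(a * y / (2 * b)), ?_⟩
    have hy' : m * b = a ^ 2 * (y ^ 2 - y) := by
      field_simp at hy; linear_combination -hy
    field_simp
    linear_combination 4 * b * hy'
  · have hlt : v a < 1 := lt_of_le_of_ne h.val_a_le ha
    have h2v : v 2 = 1 := by
      by_contra hne
      have h2lt : v 2 < 1 := lt_of_le_of_ne val_two_le hne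
      refine absurd hδ (ne_of_lt ?_)
      refine v.map_sub_lt ?_ ?_
      · rw [map_pow]; exact pow_lt_one₀ zero_le hlt (by norm_num)
      · rw [map_mul, h.val_b, mul_one, h4, map_mul]
        exact mul_lt_one_of_nonneg_of_lt_one_left zero_le h2lt h2lt.le
    obtain ⟨y, -, hy⟩ := hH (-(m / 4)) (by
      rw [v.map_neg, map_div₀, h4, map_mul, h2v]; simpa using hm)
    refine ⟨1 - 2 * y, 0, ?_⟩
    have h40 : (4 : E) ≠ 0 := by rw [h4]; exact mul_ne_zero h2 h2
    field_simp at hy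
    linear_combination -hy

/-! ### The valuation given by the reduced norm -/

section Norm

variable {s t : E}

/-- If the trace `a` were not integral, then `X² - aX + nrd x`, rescaled by `a`, would have a root
in `E` by Hensel's lemma. In a division algebra this makes `x` a scalar with integral square, so its
trace is integral after all. -/
theorem val_two_mul_re_le (hH : v.QuadraticHensel) (hD : IsDivision s t)
    {x : ℍ[E,s,0,t]} (hx : v (nrd x) ≤ 1) : v (2 * x.re) ≤ 1 := by
  by_contra! hlt
  set a := 2 * x.re with ha
  have ha0 : a ≠ 0 := by intro h; simp [h] at hlt
  obtain ⟨y, -, hy⟩ := hH (nrd x / a ^ 2) (by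
    rw [map_div₀, map_pow]
    exact (div_lt_one₀ (zero_lt_iff.2 (pow_ne_zero _ (by simpa using ha0)))).2
      (lt_of_le_of_lt hx (one_lt_pow₀ hlt (by norm_num))))
  have hroot : nrd (x - QuaternionAlgebra.coe (a * y)) = 0 := by
    have h1 : nrd (x - QuaternionAlgebra.coe (a * y)) = nrd x - a * (a * y) + (a * y) ^ 2 := by
      simp only [nrd, QuaternionAlgebra.re_sub, QuaternionAlgebra.imI_sub,
        QuaternionAlgebra.imJ_sub, QuaternionAlgebra.imK_sub, QuaternionAlgebra.re_coe,
        QuaternionAlgebra.imI_coe, QuaternionAlgebra.imJ_coe, QuaternionAlgebra.imK_coe, ha]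
      ring
    rw [h1]
    field_simp at hy
    linear_combination hy
  have hxr := sub_eq_zero.1 (hD _ hroot)
  have hre : x.re = a * y := by rw [hxr]; rfl
  rw [hxr, nrd_coe, map_pow, ← hre] at hx
  have hre' : v x.re ≤ 1 := (pow_le_one_iff (by norm_num)).1 hx
  have : v a ≤ 1 := by
    rw [ha, map_mul]; exact mul_le_one' val_two_le hre'
  exact absurd hlt (not_lt.2 this)

/-- Dividing by the larger term reduces to `nrd (z + 1) = nrd z + trd z + 1`, where integrality of
the norm gives that of the trace. -/
theorem val_nrd_add_le (hH : v.QuadraticHensel) (hD : IsDivision s t)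
    (x y : ℍ[E,s,0,t]) : v (nrd (x + y)) ≤ max (v (nrd x)) (v (nrd y)) := by
  have hone : ∀ z : ℍ[E,s,0,t], v (nrd z) ≤ 1 → v (nrd (z + 1)) ≤ 1 := by
    intro z hz
    have h1 : nrd (z + 1) = nrd z + 2 * z.re + 1 := by
      simp only [nrd, QuaternionAlgebra.re_add, QuaternionAlgebra.imI_add,
        QuaternionAlgebra.imJ_add, QuaternionAlgebra.imK_add, QuaternionAlgebra.re_one,
        QuaternionAlgebra.imI_one, QuaternionAlgebra.imJ_one, QuaternionAlgebra.imK_one]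
      ring
    rw [h1]
    exact v.map_add_le (v.map_add_le hz (val_two_mul_re_le hH hD hz)) (by simp)
  have key : ∀ x y : ℍ[E,s,0,t], v (nrd x) ≤ v (nrd y) → v (nrd (x + y)) ≤ v (nrd y) := by
    intro x y hxy
    by_cases hy : y = 0
    · subst hy; simpa using hxy
    have hy0 : nrd y ≠ 0 := fun h => hy (hD _ h)
    have hyv : v (nrd y) ≠ 0 := (v.ne_zero_iff).2 hy0
    have hyy : ((nrd y)⁻¹ • star y) * y = 1 := by
      rw [smul_mul_assoc, star_mul_self, ← QuaternionAlgebra.coe_smul, smul_eq_mul,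
        inv_mul_cancel₀ hy0, QuaternionAlgebra.coe_one]
    have hxy' : x + y = (x * ((nrd y)⁻¹ • star y) + 1) * y := by
      rw [add_mul, mul_assoc, hyy, mul_one, one_mul]
    rw [hxy', nrd_mul, map_mul]
    refine mul_le_of_le_one_left' (hone _ ?_)
    rw [nrd_mul, nrd_smul, nrd_star, map_mul, map_mul, map_pow, map_inv₀, sq]
    have : v (nrd x) * ((v (nrd y))⁻¹ * (v (nrd y))⁻¹ * v (nrd y)) = v (nrd x) / v (nrd y) := by
      field_simp
    rw [this]
    exact (div_le_one₀ (zero_lt_iff.2 hyv)).2 hxy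
  rcases le_total (v (nrd x)) (v (nrd y)) with h | h
  · exact (key x y h).trans (le_max_right _ _)
  · rw [add_comm]; exact (key y x h).trans (le_max_left _ _)

/-- A quaternion division algebra over a henselian discretely valued field contains an element which
generates a quadratic extension of the residue field. -/
theorem exists_noResidualRoot (h2 : (2 : E) ≠ 0) (hv : Function.Surjective v)
    (hH : v.QuadraticHensel) (hs : s ≠ 0) (hD : IsDivision s t) :
    ∃ x : ℍ[E,s,0,t], v.NoResidualRoot (2 * x.re) (nrd x) := by
  have hnu : ∀ x : ℍ[E,s,0,t], x ≠ 0 → v (nrd x) ≠ 0 := fun x hx =>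
    (v.ne_zero_iff).2 fun h => hx (hD x h)
  -- a subfield `E + E π` with the same values as the whole algebra
  obtain ⟨π, ⟨d, hd⟩, hπ⟩ : ∃ π : ℍ[E,s,0,t], (∃ d, d * π ≠ π * d) ∧
      ∀ x, x ≠ 0 → ∃ α β : E, v (nrd (QuaternionAlgebra.coe α + β • π)) = v (nrd x) := by
    -- If all norms have even value, scalars already have all values and `π = i` is chosen only for
    -- being noncentral. Otherwise a `π` with norm of odd value supplies the odd ones.
    by_cases hall : ∀ x : ℍ[E,s,0,t], IsSquare (v (nrd x))
    · refine ⟨⟨0, 1, 0, 0⟩, ⟨⟨0, 0, 1, 0⟩, ?_⟩, ?_⟩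
      · intro h
        have := (commute_iff_of_quaternion_basis h2 hs _).1 h
        simp at this
      · intro x hx
        obtain ⟨g, hg⟩ := hall x
        obtain ⟨c, rfl⟩ := hv g
        exact ⟨c, 0, by rw [zero_smul, add_zero, nrd_coe, map_pow, hg, sq]⟩
    · push Not at hall
      obtain ⟨π, hπ⟩ := hall
      have hπ0 : v (nrd π) ≠ 0 := fun h => hπ (by rw [h]; exact ⟨0, by simp⟩)
      refine ⟨π, ?_, ?_⟩
      · by_contra! hcen
        have hc : π ∈ Subalgebra.center E ℍ[E,s,0,t] := Subalgebra.mem_center_iff.2 hcen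
        rw [(isCentral h2 hs).center_eq_bot, Algebra.mem_bot] at hc
        obtain ⟨r, rfl⟩ := hc
        exact hπ ⟨v r, by rw [QuaternionAlgebra.coe_algebraMap, nrd_coe, map_pow, sq]⟩
      · intro x hx
        by_cases hsq : IsSquare (v (nrd x))
        · obtain ⟨g, hg⟩ := hsq
          obtain ⟨c, rfl⟩ := hv g
          exact ⟨c, 0, by rw [zero_smul, add_zero, nrd_coe, map_pow, hg, sq]⟩
        · obtain ⟨g, hg⟩ := WithZero.isSquare_mul_of_not hsq hπ
          obtain ⟨c, hc⟩ := hv (g / v (nrd π))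
          refine ⟨0, c, ?_⟩
          rw [QuaternionAlgebra.coe_zero, zero_add, nrd_smul, map_mul, map_pow, hc]
          field_simp
          rw [sq, ← hg, mul_comm]
  have hcomm0 : d * π - π * d ≠ 0 := sub_ne_zero.2 hd
  have hπ0 : π ≠ 0 := by rintro rfl; simp at hd
  have hcommle : ∀ z : ℍ[E,s,0,t], v (nrd (z * π - π * z)) ≤ v (nrd z) * v (nrd π) := by
    intro z
    have := val_nrd_add_le hH hD (z * π) (-1 * (π * z))
    rw [nrd_mul, nrd_mul, nrd_mul, map_mul, map_mul, map_mul] at this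
    have hneg : nrd (-1 : ℍ[E,s,0,t]) = 1 := by simp [nrd]
    rw [hneg, map_one, one_mul, mul_comm (v (nrd π)), max_self] at this
    simpa [sub_eq_add_neg] using this
  -- Subtracting an element of `E + E π` does not change the commutator with `π`. Together with
  -- `hcommle` this bounds the distance from `d` to `E + E π` from below, so a minimum exists in the
  -- discrete value group.
  have hcommeq : ∀ α β : E, (d - (QuaternionAlgebra.coe α + β • π)) * π -
      π * (d - (QuaternionAlgebra.coe α + β • π)) = d * π - π * d := by
    intro α β
    have := QuaternionAlgebra.coe_commutes α π
    simp only [sub_mul, mul_sub, add_mul, mul_add, smul_mul_assoc, mul_smul_comm, this]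
    abel
  have hne : ∀ α β : E, d - (QuaternionAlgebra.coe α + β • π) ≠ 0 := by
    intro α β h
    have := hcommeq α β
    rw [h] at this
    exact hcomm0 (by simpa using this.symm)
  -- the best approximation of `d` in this subfield
  obtain ⟨n, ⟨α, β, hαβ⟩, hmin⟩ := Int.exists_least_of_bdd
    (P := fun n => ∃ α β : E, WithZero.log (v (nrd (d - (QuaternionAlgebra.coe α + β • π)))) = n)
    ⟨WithZero.log (v (nrd (d * π - π * d))) - WithZero.log (v (nrd π)), by
      rintro n ⟨α, β, rfl⟩
      have h1 := hcommle (d - (QuaternionAlgebra.coe α + β • π))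
      rw [hcommeq] at h1
      rw [sub_le_iff_le_add, ← WithZero.log_mul (hnu _ (hne α β)) (hnu _ hπ0)]
      exact (WithZero.log_le_log (hnu _ hcomm0)
        (mul_ne_zero (hnu _ (hne α β)) (hnu _ hπ0))).2 h1⟩
    ⟨_, 0, 0, rfl⟩
  set e := d - (QuaternionAlgebra.coe α + β • π) with he
  have he0 : e ≠ 0 := hne α β
  have hmin' : ∀ α' β' : E, v (nrd e) ≤ v (nrd (e - (QuaternionAlgebra.coe α' + β' • π))) := by
    intro α' β'
    have h1 := hmin _ ⟨α + α', β + β', rfl⟩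
    have h3 : d - (QuaternionAlgebra.coe (α + α') + (β + β') • π) =
        e - (QuaternionAlgebra.coe α' + β' • π) := by
      rw [he, QuaternionAlgebra.coe_add, add_smul]; abel
    have h4 := hne (α + α') (β + β')
    rw [h3] at h1 h4
    rw [← hαβ] at h1
    exact (WithZero.log_le_log (hnu _ he0) (hnu _ h4)).1 h1
  obtain ⟨α₁, β₁, hm⟩ := hπ e he0
  set m := QuaternionAlgebra.coe α₁ + β₁ • π with hmdef
  have hm0 : nrd m ≠ 0 := by
    intro h
    rw [h, map_zero] at hm
    exact hnu e he0 hm.symm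
  have hmv : v (nrd m) ≠ 0 := (v.ne_zero_iff).2 hm0
  -- This is `m⁻¹ e`, of norm value `1`. Since `x - y = m⁻¹ (e - m y)` and `m y` lies in `E + E π`,
  -- minimality of `e` gives `v (nrd (x - y)) ≥ 1` for every scalar `y`.
  set x := (nrd m)⁻¹ • (star m * e) with hx
  have hnx : v (nrd x) = 1 := by
    rw [hx, nrd_smul, nrd_mul, nrd_star, map_mul, map_mul, map_pow, map_inv₀, ← hm]
    field_simp
  have hsub : ∀ y : E, nrd (x - QuaternionAlgebra.coe y) = y ^ 2 - 2 * x.re * y + nrd x := by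
    intro y
    simp only [nrd, QuaternionAlgebra.re_sub, QuaternionAlgebra.imI_sub,
        QuaternionAlgebra.imJ_sub, QuaternionAlgebra.imK_sub, QuaternionAlgebra.re_coe,
        QuaternionAlgebra.imI_coe, QuaternionAlgebra.imJ_coe, QuaternionAlgebra.imK_coe]
    ring
  refine ⟨x, val_two_mul_re_le hH hD hnx.le, hnx.le, ?_⟩
  intro y hy
  apply le_antisymm
  · refine v.map_add_le (v.map_sub_le ?_ ?_) hnx.le
    · rw [map_pow]; exact pow_le_one₀ zero_le hy
    · rw [map_mul]; exact mul_le_one' (val_two_mul_re_le hH hD hnx.le) hy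
  · rw [← hsub]
    have h1 : x - QuaternionAlgebra.coe y =
        ((nrd m)⁻¹ • star m) * (e - (QuaternionAlgebra.coe (y * α₁) + (y * β₁) • π)) := by
      have h3 : QuaternionAlgebra.coe (y * α₁) + (y * β₁) • π = m * QuaternionAlgebra.coe y := by
        rw [QuaternionAlgebra.mul_coe_eq_smul, hmdef, smul_add, smul_smul,
          QuaternionAlgebra.smul_coe]
      rw [h3, mul_sub, hx, smul_mul_assoc, smul_mul_assoc, ← mul_assoc, star_mul_self,
        QuaternionAlgebra.coe_mul_eq_smul, smul_smul, inv_mul_cancel₀ hm0, one_smul]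
    rw [h1, nrd_mul, nrd_smul, nrd_star, map_mul, map_mul, map_pow, map_inv₀]
    have h3 := hmin' (y * α₁) (y * β₁)
    rw [← hm] at h3
    calc (1 : ℤᵐ⁰) = (v (nrd m))⁻¹ ^ 2 * v (nrd m) * v (nrd m) := by field_simp
      _ ≤ _ := mul_le_mul_right h3 _

/-- In a division algebra `(δ, r)` with `E(√δ)` unramified and `r` of even valuation, all reduced
norms have even valuation. -/
theorem NoResidualRoot.isSquare_val_nrd {a b δ r : E} (hδdef : δ = a ^ 2 - 4 * b)
    (h2 : (2 : E) ≠ 0) (hH : v.QuadraticHensel)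
    (h : v.NoResidualRoot a b) (hδ : v δ = 1) (hr : IsSquare (v r))
    (hD : IsDivision δ r) (x : ℍ[E,δ,0,r]) : IsSquare (v (nrd x)) := by
  set p := x.re ^ 2 - δ * x.imI ^ 2 with hp
  set q := x.imJ ^ 2 - δ * x.imK ^ 2 with hq
  have hx : nrd x = p - r * q := by rw [hp, hq, nrd]; ring
  have hnorm : ∀ y z : E, IsSquare (v (y ^ 2 - δ * z ^ 2)) := by
    intro y z
    rw [hδdef]
    exact h.isSquare_val_norm y z
  have hpe : IsSquare (v p) := hnorm _ _
  have hqe : IsSquare (v (r * q)) := by rw [map_mul]; exact hr.mul (hnorm _ _)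
  rw [hx]
  rcases lt_trichotomy (v p) (v (r * q)) with hlt | heq | hlt
  · rwa [v.map_sub_eq_of_lt_right hlt]
  · by_cases hq0 : r * q = 0
    · rw [hq0, sub_zero]; exact hpe
    have hqv : v (r * q) ≠ 0 := (v.ne_zero_iff).2 hq0
    rcases lt_or_eq_of_le (v.map_sub p (r * q)) with hlt | he
    -- Cancellation in `p - r q` would mean `p = r q (1 + m)` with `v m < 1`. As `1 + m`, `p` and
    -- `q` are norms from `E(√δ)`, so would be `r`, and the algebra would be split.
    · exfalso
      rw [heq, max_self] at hlt
      have hm : v ((p - r * q) / (r * q)) < 1 := by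
        rw [map_div₀]; exact (div_lt_one₀ (zero_lt_iff.2 hqv)).2 hlt
      have hn := h.isNorm_one_add h2 hH (hδdef ▸ hδ) hm
      rw [← hδdef] at hn
      have hr0 : r ≠ 0 := left_ne_zero_of_mul hq0
      have hqq : q ≠ 0 := right_ne_zero_of_mul hq0
      apply hD.not_isNorm
      have hpq : IsNorm δ (p / q) := IsNorm.div ⟨_, _, hp⟩ ⟨_, _, hq⟩
      have := hpq.div hn
      convert this using 1
      have hp0 : p ≠ 0 := by
        rintro h0; rw [h0, map_zero] at heq; exact hqv heq.symm
      have h1 : 1 + (p - r * q) / (r * q) = p / (r * q) := by field_simp; ring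
      rw [h1]
      field_simp
    · rw [he, heq, max_self]; exact hqe
  · rwa [v.map_sub_eq_of_lt_left hlt]

end Norm

/-- If the quaternion algebras `(s, t₁)` and `(s, t₂)` over a henselian discretely valued field have
the same squares of pure quaternions, then `(s, t₁ t₂)` is split or contains an element generating a
quadratic extension of the residue field, and it is unramified if this extension is separable. -/
theorem split_or_exists_noResidualRoot (h2 : (2 : E) ≠ 0) (hv : Function.Surjective v)
    (hH : v.QuadraticHensel) {s t₁ t₂ : E} (hs : s ≠ 0) (ht₁ : t₁ ≠ 0) (ht₂ : t₂ ≠ 0)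
    (hrep : ∀ r : E, r ≠ 0 → (Represents s t₁ r ↔ Represents s t₂ r)) :
    Iso s (t₁ * t₂) 1 1 ∨ ∃ a b r : E, v.NoResidualRoot a b ∧ r ≠ 0 ∧
      Iso s (t₁ * t₂) (a ^ 2 - 4 * b) r ∧ (v (a ^ 2 - 4 * b) = 1 → IsSquare (v r)) := by
  have ht := mul_ne_zero ht₁ ht₂
  -- Being split is detected by whether `1` is a pure square, so the two algebras are split
  -- simultaneously.
  by_cases hn₁ : IsNorm s t₁
  · left
    have hn₂ : IsNorm s t₂ := isNorm_of_represents_one h2 hs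
      ((hrep 1 one_ne_zero).1 (represents_one_of_isNorm h2 ht₁ hn₁))
    exact iso_one_one_of_isNorm h2 hs ht (hn₁.mul hn₂)
  right
  have hn₂ : ¬ IsNorm s t₂ := fun hn₂ => hn₁ (isNorm_of_represents_one h2 hs
      ((hrep 1 one_ne_zero).2 (represents_one_of_isNorm h2 ht₂ hn₂)))
  have hD₁ := isDivision_of_not_isNorm h2 hs hn₁
  have hD₂ := isDivision_of_not_isNorm h2 hs hn₂
  obtain ⟨x, hx⟩ := exists_noResidualRoot h2 hv hH hs hD₁
  set a := 2 * x.re with ha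
  set b := nrd x with hb
  have hδ0 := hx.disc_ne_zero h2
  -- The discriminant is the square of the pure quaternion `2 x - trd x`.
  have hrep₁ : Represents s t₁ (a ^ 2 - 4 * b) :=
    ⟨2 * x.imI, 2 * x.imJ, 2 * x.imK, by simp only [pureSq, ha, hb, nrd]; ring⟩
  obtain ⟨r₁, r₂, hr₁, hr₂, i₁, i₂, i₃⟩ := exists_common_slot h2 hs ht₁ ht₂ hδ0
    (hD₁.not_isSquare h2 hs) hrep₁ ((hrep _ hδ0).1 hrep₁)
  have hD₁' : IsDivision (a ^ 2 - 4 * b) r₁ := by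
    refine isDivision_of_not_isNorm h2 hδ0 fun hn => ?_
    exact hn₁ (isNorm_of_represents_one h2 hs
      (i₁.symm.represents h2 (represents_one_of_isNorm h2 hr₁ hn)))
  have hD₂' : IsDivision (a ^ 2 - 4 * b) r₂ := by
    refine isDivision_of_not_isNorm h2 hδ0 fun hn => ?_
    exact hn₂ (isNorm_of_represents_one h2 hs
      (i₂.symm.represents h2 (represents_one_of_isNorm h2 hr₂ hn)))
  refine ⟨a, b, r₁ * r₂, hx, mul_ne_zero hr₁ hr₂, i₃, fun hδ => ?_⟩
  have hself : ∀ r : E, Represents (a ^ 2 - 4 * b) r r := fun r => ⟨0, 1, 0, by simp [pureSq]⟩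
  have hval : ∀ r r' : E, IsDivision (a ^ 2 - 4 * b) r → IsSquare (v r) →
      Represents (a ^ 2 - 4 * b) r r' → IsSquare (v r') := by
    rintro r r' hD hr ⟨c, d, e, rfl⟩
    have := hx.isSquare_val_nrd rfl h2 hH hδ hr hD ⟨0, c, d, e⟩
    rw [← v.map_neg] at this
    convert this using 2
    simp only [nrd, pureSq]; ring
  rw [map_mul]
  -- `r₂` is a pure square in `(δ, r₁)` and conversely, so evenness of one value forces evenness of
  -- the other; two odd values also have an even sum.
  by_cases h₁ : IsSquare (v r₁)
  · refine h₁.mul (hval r₁ r₂ hD₁' h₁ ?_)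
    exact i₁.represents h2 ((hrep _ hr₂).2 (i₂.symm.represents h2 (hself r₂)))
  · refine WithZero.isSquare_mul_of_not h₁ fun h₂ => h₁ (hval r₂ r₁ hD₂' h₂ ?_)
    exact i₂.represents h2 ((hrep _ hr₁).1 (i₁.symm.represents h2 (hself r₁)))

end Valuation

/-! ### Finite extensions of complete discretely valued fields -/

/-- The root is the limit of the iteration `z ↦ z² + c` from `0`, which contracts the ball of radius
`‖c‖` by the factor `‖c‖`. -/
theorem exists_root_of_norm_lt_one {K : Type*} [NormedField K] [CompleteSpace K]
    (hK : ∀ x y : K, ‖x + y‖ ≤ max ‖x‖ ‖y‖) {c : K} (hc : ‖c‖ < 1) :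
    ∃ y : K, ‖y‖ < 1 ∧ y ^ 2 - y + c = 0 := by
  let y : ℕ → K := fun n => Nat.rec 0 (fun _ z => z ^ 2 + c) n
  have hy : ∀ n, y (n + 1) = y n ^ 2 + c := fun n => rfl
  have hle : ∀ n, ‖y n‖ ≤ ‖c‖ := by
    intro n
    induction n with
    | zero => simp [y]
    | succ n ih =>
      rw [hy]
      refine (hK _ _).trans (max_le ?_ le_rfl)
      rw [norm_pow, sq]
      exact (mul_le_of_le_one_left (norm_nonneg _) (ih.trans hc.le)).trans ih
  have hdist : ∀ n, dist (y n) (y (n + 1)) ≤ 1 * ‖c‖ ^ n := by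
    intro n
    induction n with
    | zero =>
      rw [dist_comm, dist_eq_norm]
      simpa [y] using hc.le
    | succ n ih =>
      rw [dist_eq_norm] at ih ⊢
      have : y (n + 1) - y (n + 1 + 1) = (y n - y (n + 1)) * (y n + y (n + 1)) := by
        rw [hy (n + 1), hy n]; ring
      rw [this, norm_mul, pow_succ, ← mul_assoc]
      exact mul_le_mul ih ((hK (y n) (y (n + 1))).trans (max_le (hle n) (hle (n + 1)))) (norm_nonneg _) (by positivity)
  obtain ⟨z, hz⟩ := cauchySeq_tendsto_of_complete (cauchySeq_of_le_geometric _ _ hc hdist)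
  have hz1 : ‖z‖ ≤ ‖c‖ := le_of_tendsto hz.norm (Filter.Eventually.of_forall hle)
  have hz2 : Filter.Tendsto (fun n => y (n + 1)) Filter.atTop (nhds (z ^ 2 + c)) := by
    simp only [hy]
    exact (hz.pow 2).add_const c
  have := tendsto_nhds_unique ((Filter.tendsto_add_atTop_iff_nat 1).2 hz) hz2
  exact ⟨z, hz1.trans_lt hc, by linear_combination -this⟩

namespace Valuation

open WithZeroMulInt

/-- The absolute value attached to a valuation with values in `ℤᵐ⁰`. -/
noncomputable def toAbsoluteValue {L : Type*} [Field L] (w : Valuation L ℤᵐ⁰) :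
    AbsoluteValue L ℝ where
  toFun x := toNNReal (two_ne_zero (α := NNReal)) (w x)
  map_mul' x y := by simp
  nonneg' x := NNReal.coe_nonneg _
  eq_zero' x := by simp
  add_le' x y := by
    have h := (toNNReal_strictMono (one_lt_two (α := NNReal))).monotone (w.map_add x y)
    rw [(toNNReal_strictMono (one_lt_two (α := NNReal))).monotone.map_max] at h
    refine le_trans (NNReal.coe_le_coe.2 h) ?_
    rw [NNReal.coe_max]
    exact max_le_add_of_nonneg (NNReal.coe_nonneg _) (NNReal.coe_nonneg _)

theorem toAbsoluteValue_le_iff {L : Type*} [Field L] (w : Valuation L ℤᵐ⁰) {x y : L} :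
    w.toAbsoluteValue x ≤ w.toAbsoluteValue y ↔ w x ≤ w y := by
  refine NNReal.coe_le_coe.trans ?_
  exact (toNNReal_strictMono (one_lt_two (α := NNReal))).le_iff_le

theorem toAbsoluteValue_lt_iff {L : Type*} [Field L] (w : Valuation L ℤᵐ⁰) {x y : L} :
    w.toAbsoluteValue x < w.toAbsoluteValue y ↔ w x < w y := by
  simpa using not_congr (w.toAbsoluteValue_le_iff (x := y) (y := x))

theorem toAbsoluteValue_add_le {L : Type*} [Field L] (w : Valuation L ℤᵐ⁰) (x y : L) :
    w.toAbsoluteValue (x + y) ≤ max (w.toAbsoluteValue x) (w.toAbsoluteValue y) := by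
  rcases le_total (w x) (w y) with h | h
  · rw [max_eq_right ((w.toAbsoluteValue_le_iff).2 h), toAbsoluteValue_le_iff]
    exact (w.map_add x y).trans (max_le h le_rfl)
  · rw [max_eq_left ((w.toAbsoluteValue_le_iff).2 h), toAbsoluteValue_le_iff]
    exact (w.map_add x y).trans (max_le le_rfl h)

/-! ### Uniqueness of extended absolute values and Hensel's lemma -/

section Complete

variable {E : Type*} [Field E] [Valued E ℤᵐ⁰] [CompleteSpace E]

open MonoidWithZeroHom

/-- The rank one structure on a discrete valuation which gives the absolute value
`Valuation.toAbsoluteValue`. -/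
noncomputable abbrev rankOneOfSurjective
    (hv : Function.Surjective (Valued.v : Valuation E ℤᵐ⁰)) :
    (Valued.v : Valuation E ℤᵐ⁰).RankOne where
  hom' := (toNNReal (two_ne_zero (α := NNReal))).comp ValueGroup₀.embedding
  strictMono' := (toNNReal_strictMono (one_lt_two (α := NNReal))).comp ValueGroup₀.embedding_strictMono
  exists_val_nontrivial := by
    obtain ⟨x, hx⟩ := hv (WithZero.exp 1)
    exact ⟨x, by rw [hx]; simp, by rw [hx]; simp⟩

variable {L : Type*} [Field L] [Algebra E L] [FiniteDimensional E L] {w : Valuation L ℤᵐ⁰}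

/-- A valuation extending the valuation of a complete discretely valued field to a finite extension
is invariant under automorphisms, and Hensel's lemma holds for it. -/
theorem invariant_and_quadraticHensel (hv : Function.Surjective (Valued.v : Valuation E ℤᵐ⁰))
    (hw : w.comap (algebraMap E L) = Valued.v) :
    (∀ (σ : L ≃ₐ[E] L) (x : L), w (σ x) = w x) ∧ w.QuadraticHensel := by
  let _ := rankOneOfSurjective hv
  let _ : NontriviallyNormedField E := Valued.toNontriviallyNormedField E ℤᵐ⁰
  have hnorm : ∀ x : E, w.toAbsoluteValue (algebraMap E L x) = ‖x‖ := by
    intro x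
    rw [Valued.toNormedField.norm_def]
    have h1 : w (algebraMap E L x) = Valued.v x := by rw [← hw]; rfl
    change ((toNNReal (two_ne_zero (α := NNReal)) (w (algebraMap E L x)) : NNReal) : ℝ) = _
    rw [h1]
    change _ = ((toNNReal (two_ne_zero (α := NNReal)) (ValueGroup₀.embedding (Valued.v.restrict x)) : NNReal) : ℝ)
    rw [Valuation.embedding_restrict]
  refine ⟨fun σ x => ?_, ?_⟩
  -- Both `w` and `w ∘ σ` extend the absolute value of `E`, so both give the spectral norm.
  · let f := w.toAbsoluteValue
    let g := (w.comap (σ : L →+* L)).toAbsoluteValue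
    have hf := spectralNorm_unique_field_norm_ext (K := E) (f := f) hnorm x
    have hg := spectralNorm_unique_field_norm_ext (K := E) (f := g) (fun y => by
      rw [← hnorm y]
      change ((toNNReal (two_ne_zero (α := NNReal)) (w (σ (algebraMap E L y))) : NNReal) : ℝ) = _
      rw [σ.commutes]; rfl) x
    have h := hg.trans hf.symm
    exact (toNNReal_strictMono (one_lt_two (α := NNReal))).injective (NNReal.coe_injective h)
  · let _ : NormedField L := w.toAbsoluteValue.toNormedField
    have hL : ∀ x : L, ‖x‖ = w.toAbsoluteValue x := fun x => rfl
    let _ : NormedSpace E L :=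
      { (inferInstance : Module E L) with
        norm_smul_le := fun a x => by
          rw [hL, hL, Algebra.smul_def, map_mul, hnorm] }
    have : CompleteSpace L := FiniteDimensional.complete E L
    intro c hc
    rw [← map_one w, ← toAbsoluteValue_lt_iff, map_one] at hc
    obtain ⟨y, hy, hroot⟩ := exists_root_of_norm_lt_one (K := L) w.toAbsoluteValue_add_le hc
    refine ⟨y, ?_, hroot⟩
    rw [← map_one w, ← toAbsoluteValue_lt_iff, map_one]
    exact hy

theorem quadraticHensel_of_complete (hv : Function.Surjective (Valued.v : Valuation E ℤᵐ⁰)) :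
    (Valued.v : Valuation E ℤᵐ⁰).QuadraticHensel :=
  (invariant_and_quadraticHensel (E := E) (L := E) hv rfl).2

end Complete

end Valuation

/-! ### Ramification of crossed products -/

namespace Valuation

/-- A nontrivial zero gives a root `y = -α / β` in `L`. It cannot be integral, and if it is not, `1
= a y⁻¹ - b y⁻²` lies in the maximal ideal. -/
theorem NoResidualRoot.eq_zero {L : Type*} [Field L] {w : Valuation L ℤᵐ⁰} {a b : L}
    (h : w.NoResidualRoot a b) {α β : L} (h0 : α ^ 2 + a * α * β + b * β ^ 2 = 0) :
    α = 0 ∧ β = 0 := by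
  have hβ : β = 0 := by
    by_contra hβ
    have hroot : (-α / β) ^ 2 - a * (-α / β) + b = 0 := by
      field_simp; linear_combination h0
    set y := -α / β with hy
    rcases le_or_gt (w y) 1 with hle | hlt
    · have := h.val_eq_one y hle
      rw [hroot, map_zero] at this
      exact zero_ne_one this
    · have hy0 : y ≠ 0 := by intro h'; rw [h', map_zero] at hlt; simp at hlt
      have hz : w y⁻¹ < 1 := by rw [map_inv₀]; exact inv_lt_one_of_one_lt₀ hlt
      have h1 : (1 : L) = a * y⁻¹ - b * y⁻¹ ^ 2 := by
        field_simp; linear_combination hroot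
      have h2 : w (a * y⁻¹ - b * y⁻¹ ^ 2) < 1 := by
        refine w.map_sub_lt ?_ ?_
        · rw [map_mul]; exact (mul_le_of_le_one_left' h.val_a_le).trans_lt hz
        · rw [map_mul, map_pow]
          exact (mul_le_of_le_one_left' h.val_b_le).trans_lt (pow_lt_one₀ zero_le hz (by norm_num))
      rw [← h1, map_one] at h2
      exact lt_irrefl _ h2
  subst hβ
  exact ⟨by simpa using h0, rfl⟩

end Valuation

/-! ### Twisted planes and the valuation of the cocycle -/

section Semilinear

variable {E L : Type*} [Field E] [Field L] [Algebra E L] {w : Valuation L ℤᵐ⁰}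
  {f : Gal(L/E) → Gal(L/E) → Lˣ} {P : Type*} [AddCommGroup P] [Module L P]
  {u : Gal(L/E) → P →+ P}

/-- A twisted representation of the Galois group on a plane: `u σ` is `σ`-semilinear and
`u σ u τ = f σ τ u (σ τ)`. -/
structure IsTwistedRepresentation (f : Gal(L/E) → Gal(L/E) → Lˣ) (u : Gal(L/E) → P →+ P) :
    Prop where
  smul : ∀ σ (l : L) p, u σ (l • p) = σ l • u σ p
  mul : ∀ σ τ p, u σ (u τ p) = (f σ τ : L) • u (σ * τ) p
  eq_zero : ∀ σ p, u σ p = 0 → p = 0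
  finrank : Module.finrank L P = 2

/-- If a twisted representation on a plane commutes with a quadratic operator `Y` whose
norm form takes values of even valuation on the coefficients, then the valuation of the cocycle is
a coboundary. -/
theorem IsTwistedRepresentation.exists_coboundary_of_norm (hu : IsTwistedRepresentation f u)
    (hw : ∀ (σ : Gal(L/E)) (x : L), w (σ x) = w x) (Y : P →ₗ[L] P) {a b : E}
    (hY : ∀ p, Y (Y p) = algebraMap E L a • Y p - algebraMap E L b • p)
    (huY : ∀ σ p, u σ (Y p) = Y (u σ p)) {p : P} (hp : LinearIndependent L ![p, Y p])
    (hN : ∀ σ (α β : L), u σ p = α • p + β • Y p →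
      α ^ 2 + algebraMap E L a * α * β + algebraMap E L b * β ^ 2 ≠ 0 ∧
      IsSquare (w (α ^ 2 + algebraMap E L a * α * β + algebraMap E L b * β ^ 2))) :
    ∃ g : Gal(L/E) → ℤ, ∀ σ τ, WithZero.log (w (f σ τ)) = g σ + g τ - g (σ * τ) := by
  have : FiniteDimensional L P := .of_finrank_pos (by rw [hu.finrank]; norm_num)
  have hspan := hp.span_eq_top_of_card_eq_finrank' (by simp [hu.finrank])
  rw [Matrix.range_cons_cons_empty] at hspan
  have hex : ∀ σ, ∃ α β : L, α • p + β • Y p = u σ p := by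
    intro σ
    rw [← Submodule.mem_span_pair, hspan]
    trivial
  choose α β hαβ using hex
  rw [LinearIndependent.pair_iff] at hp
  set a' := algebraMap E L a
  set b' := algebraMap E L b
  let N : Gal(L/E) → L := fun σ => α σ ^ 2 + a' * α σ * β σ + b' * β σ ^ 2
  have hN0 : ∀ σ, N σ ≠ 0 := fun σ => (hN σ _ _ (hαβ σ).symm).1
  have hNw : ∀ σ, w (N σ) ≠ 0 := fun σ => w.ne_zero_iff.2 (hN0 σ)
  have hNs : ∀ σ, ∃ n : ℤ, WithZero.log (w (N σ)) = n + n := fun σ =>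
    (WithZero.isSquare_iff_even_log (hNw σ)).1 (hN σ _ _ (hαβ σ).symm).2
  choose g hg using hNs
  refine ⟨g, fun σ τ => ?_⟩
  have hcomp := hu.mul σ τ p
  rw [← hαβ τ, map_add, hu.smul, hu.smul, huY, ← hαβ σ, ← hαβ (σ * τ)] at hcomp
  simp only [map_add, map_smul, hY] at hcomp
  have hlin : (σ (α τ) * α σ - b' * σ (β τ) * β σ - f σ τ * α (σ * τ)) • p +
      (σ (α τ) * β σ + σ (β τ) * α σ + a' * σ (β τ) * β σ - f σ τ * β (σ * τ)) • Y p = 0 := by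
    linear_combination (norm := module) hcomp
  obtain ⟨h1, h2⟩ := hp _ _ hlin
  have hσN : σ (N τ) = σ (α τ) ^ 2 + a' * σ (α τ) * σ (β τ) + b' * σ (β τ) ^ 2 := by
    simp only [N, map_add, map_mul, map_pow, a', b', AlgEquiv.commutes]
  -- Identify the plane with `L[Y] p`. Then `u σ (u τ p) = f σ τ • u (σ τ) p` is an identity in
  -- `L[Y]`, and this is its norm to `L`. Half the values of `N` form the required cochain.
  have hprod : σ (N τ) * N σ = (f σ τ : L) ^ 2 * N (σ * τ) := by
    rw [hσN]
    have h1' : f σ τ * α (σ * τ) = σ (α τ) * α σ - b' * σ (β τ) * β σ := by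
      linear_combination -h1
    have h2' : f σ τ * β (σ * τ) =
        σ (α τ) * β σ + σ (β τ) * α σ + a' * σ (β τ) * β σ := by
      linear_combination -h2
    have : (f σ τ : L) ^ 2 * N (σ * τ) = (f σ τ * α (σ * τ)) ^ 2 +
        a' * (f σ τ * α (σ * τ)) * (f σ τ * β (σ * τ)) + b' * (f σ τ * β (σ * τ)) ^ 2 := by
      simp only [N]; ring
    rw [this, h1', h2']
    simp only [N]; ring
  have hlog := congrArg (fun x => WithZero.log (w x)) hprod
  simp only [map_mul, map_pow, hw] at hlog
  have hfw : w (f σ τ : L) ≠ 0 := w.ne_zero_iff.2 (f σ τ).ne_zero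
  rw [WithZero.log_mul (hNw τ) (hNw σ), WithZero.log_mul (pow_ne_zero 2 hfw) (hNw _),
    WithZero.log_pow, hg, hg, hg] at hlog
  simp only [nsmul_eq_mul, Nat.cast_ofNat] at hlog
  omega

/-- The norm form of `X` is anisotropic with values of even valuation, so any nonzero `p` serves. -/
theorem IsTwistedRepresentation.exists_coboundary_of_noResidualRoot
    (hu : IsTwistedRepresentation f u)
    (hw : ∀ (σ : Gal(L/E)) (x : L), w (σ x) = w x) (X : P →ₗ[L] P) {a b : E}
    (hX : ∀ p, X (X p) = algebraMap E L a • X p - algebraMap E L b • p)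
    (huX : ∀ σ p, u σ (X p) = X (u σ p))
    (hab : w.NoResidualRoot (algebraMap E L a) (algebraMap E L b)) :
    ∃ g : Gal(L/E) → ℤ, ∀ σ τ, WithZero.log (w (f σ τ)) = g σ + g τ - g (σ * τ) := by
  have : Nontrivial P := Module.nontrivial_of_finrank_pos (R := L) (by rw [hu.finrank]; norm_num)
  obtain ⟨p, hp⟩ := exists_ne (0 : P)
  have hind : ∀ α β : L, α • p + β • X p = 0 → α = 0 ∧ β = 0 := by
    intro α β h0
    have h1 := congrArg X h0
    simp only [map_add, map_smul, hX, map_zero] at h1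
    have h2 : (α ^ 2 + algebraMap E L a * α * β + algebraMap E L b * β ^ 2) • p = 0 := by
      linear_combination (norm := module) (α + algebraMap E L a * β) • h0 - β • h1
    exact hab.eq_zero ((smul_eq_zero.1 h2).resolve_right hp)
  refine hu.exists_coboundary_of_norm hw X hX huX (p := p)
    (LinearIndependent.pair_iff.2 hind) fun σ α β hσ => ⟨fun h0 => ?_, hab.isSquare_val α β⟩
  obtain ⟨rfl, rfl⟩ := hab.eq_zero h0
  exact hp (hu.eq_zero σ p (by rw [hσ]; simp))

/-- For an eigenvector `p` of `I`, each `u σ p` lies on the line of `p` or of `J p`. The norm form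
`α² - t β²` of `J` is then evaluated only with `α β = 0`, where evenness of the value of `t` is
enough. -/
theorem IsTwistedRepresentation.exists_coboundary_of_sqrt
    (hu : IsTwistedRepresentation f u) (h2 : (2 : L) ≠ 0)
    (hw : ∀ (σ : Gal(L/E)) (x : L), w (σ x) = w x) (I J : P →ₗ[L] P) {δ t : E} {η : L}
    (hη : η ≠ 0) (hηδ : η ^ 2 = algebraMap E L δ) (ht : t ≠ 0)
    (hwt : IsSquare (w (algebraMap E L t)))
    (hI : ∀ p, I (I p) = algebraMap E L δ • p) (hJ : ∀ p, J (J p) = algebraMap E L t • p)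
    (hIJ : ∀ p, I (J p) = -J (I p))
    (huI : ∀ σ p, u σ (I p) = I (u σ p)) (huJ : ∀ σ p, u σ (J p) = J (u σ p)) :
    ∃ g : Gal(L/E) → ℤ, ∀ σ τ, WithZero.log (w (f σ τ)) = g σ + g τ - g (σ * τ) := by
  have : Nontrivial P := Module.nontrivial_of_finrank_pos (R := L) (by rw [hu.finrank]; norm_num)
  obtain ⟨q, hq⟩ := exists_ne (0 : P)
  have htL : algebraMap E L t ≠ 0 := (map_ne_zero _).2 ht
  obtain ⟨θ, p, hθδ, hp, hIp⟩ : ∃ (θ : L) (p : P), θ ^ 2 = algebraMap E L δ ∧ p ≠ 0 ∧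
      I p = θ • p := by
    -- Either `q` is an eigenvector for `-η`, or `I q + η q` is one for `η`.
    by_cases h : I q + η • q = 0
    · exact ⟨-η, q, by rw [neg_sq, hηδ], hq, by rw [neg_smul]; exact eq_neg_of_add_eq_zero_left h⟩
    · refine ⟨η, _, hηδ, h, ?_⟩
      rw [map_add, map_smul, hI, ← hηδ]
      module
  have hθ : θ ≠ 0 := by
    rintro rfl
    apply hη
    rw [← hθδ] at hηδ
    simpa using hηδ
  have hJp : J p ≠ 0 := by
    intro h
    have := hJ p
    rw [h, map_zero] at this
    exact (smul_ne_zero htL hp) this.symm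
  have hIJp : I (J p) = -(θ • J p) := by rw [hIJ, hIp, map_smul]
  have hind : ∀ α β : L, α • p + β • J p = 0 → α = 0 ∧ β = 0 := by
    intro α β h0
    have h1 := congrArg I h0
    simp only [map_add, map_smul, hIp, hIJp, map_zero] at h1
    have e1 : (2 * θ * α) • p = 0 := by linear_combination (norm := module) θ • h0 + h1
    have e2 : (2 * θ * β) • J p = 0 := by linear_combination (norm := module) θ • h0 - h1
    constructor
    · simpa [h2, hθ, hp] using e1
    · simpa [h2, hθ, hJp] using e2
  refine hu.exists_coboundary_of_norm hw J (a := 0) (b := -t) (fun p => by simp [hJ]) huJ (p := p)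
    (LinearIndependent.pair_iff.2 hind) fun σ α β hσ => ?_
  -- `u σ` is semilinear and commutes with `I`, so it sends the `θ`-eigenvector `p` to an
  -- eigenvector for `σ θ = ± θ`.
  have h1 := huI σ p
  rw [hIp, hu.smul, hσ] at h1
  simp only [map_add, map_smul, hIp, hIJp] at h1
  obtain ⟨e1, e2⟩ := hind ((σ θ - θ) * α) ((σ θ + θ) * β) (by
    linear_combination (norm := module) h1)
  have hsq : (σ θ - θ) * (σ θ + θ) = 0 := by
    have : (σ θ) ^ 2 = θ ^ 2 := by rw [← map_pow, hθδ, AlgEquiv.commutes]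
    linear_combination this
  have hαβ : (α = 0 ∧ β ≠ 0) ∨ (α ≠ 0 ∧ β = 0) := by
    have hne : ¬ (α = 0 ∧ β = 0) := by
      rintro ⟨rfl, rfl⟩
      exact hp (hu.eq_zero σ p (by rw [hσ]; simp))
    rcases mul_eq_zero.1 hsq with h | h
    · have : σ θ + θ ≠ 0 := by
        intro h'
        have : 2 * θ = 0 := by linear_combination h' - h
        simp [h2, hθ] at this
      have hβ : β = 0 := (mul_eq_zero.1 e2).resolve_left this
      exact Or.inr ⟨fun h' => hne ⟨h', hβ⟩, hβ⟩
    · have : σ θ - θ ≠ 0 := by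
        intro h'
        have : 2 * θ = 0 := by linear_combination h - h'
        simp [h2, hθ] at this
      have hα : α = 0 := (mul_eq_zero.1 e1).resolve_left this
      exact Or.inl ⟨hα, fun h' => hne ⟨hα, h'⟩⟩
  rcases hαβ with ⟨rfl, hβ⟩ | ⟨hα, rfl⟩
  · refine ⟨by simp [hβ, ht], ?_⟩
    have : (0 : L) ^ 2 + algebraMap E L 0 * 0 * β + algebraMap E L (-t) * β ^ 2 =
        -(algebraMap E L t * β ^ 2) := by simp
    rw [this, w.map_neg, map_mul, map_pow]
    exact hwt.mul ⟨w β, sq _⟩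
  · refine ⟨by simp [hα], ⟨w α, by simp [sq]⟩⟩

end Semilinear

/-- Averaging over `τ` cancels `g τ` against `g (σ τ)` and leaves the integer `-g σ`. -/
theorem ramificationCharacter_eq_zero_of_coboundary {E L : Type*} [Field E] [Field L] [Algebra E L]
    [FiniteDimensional E L] {w : Valuation L ℤᵐ⁰} {f : Gal(L/E) → Gal(L/E) → Lˣ}
    {g : Gal(L/E) → ℤ}
    (hg : ∀ σ τ, WithZero.log (w (f σ τ)) = g σ + g τ - g (σ * τ)) :
    ramificationCharacter w f = 0 := by
  funext σ
  have hsum : ∑ τ : Gal(L/E), -((WithZero.log (w (f σ τ)) : ℤ) : ℚ) =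
      -(g σ : ℚ) * (Fintype.card Gal(L/E) : ℚ) := by
    have h1 : ∑ τ : Gal(L/E), (g (σ * τ) : ℚ) = ∑ τ : Gal(L/E), (g τ : ℚ) :=
      Fintype.sum_equiv (Equiv.mulLeft σ) _ _ fun τ => rfl
    simp only [hg, Int.cast_sub, Int.cast_add, neg_sub, Finset.sum_sub_distrib,
      Finset.sum_add_distrib, h1, Finset.sum_const, Finset.card_univ, nsmul_eq_mul]
    ring
  have hc : (Fintype.card Gal(L/E) : ℚ) ≠ 0 := by
    exact_mod_cast Fintype.card_ne_zero
  rw [ramificationCharacter, hsum, mul_div_cancel_right₀ _ hc, Pi.zero_apply,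
    AddCircle.coe_eq_zero_iff]
  exact ⟨-g σ, by simp⟩

/-! ### Quadratic polynomials over unramified extensions -/

namespace Valuation

/-- The derivative `τ = 2 y - a` at the approximate root is a unit because `τ² = δ + 4 p`. Hensel's
lemma corrects `y` to a root `y - τ z`, where the derivative is a square root of `δ`. -/
theorem exists_sqrt_disc_of_approx_root {L : Type*} [Field L] {w : Valuation L ℤᵐ⁰}
    (hH : w.QuadraticHensel) {a b y : L} (hδ : w (a ^ 2 - 4 * b) = 1)
    (hy : w (y ^ 2 - a * y + b) < 1) : ∃ η : L, η ^ 2 = a ^ 2 - 4 * b := by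
  set p := y ^ 2 - a * y + b with hp
  set τ := 2 * y - a with hτ
  have h4 : w (4 * p) < 1 := by
    rw [show (4 : L) = 2 * 2 by norm_num, map_mul, map_mul]
    exact (mul_le_of_le_one_left' (mul_le_one' val_two_le val_two_le)).trans_lt hy
  have hττ : w (τ ^ 2) = 1 := by
    have : τ ^ 2 = (a ^ 2 - 4 * b) + 4 * p := by rw [hτ, hp]; ring
    rw [this, w.map_add_eq_of_lt_left (by rwa [hδ]), hδ]
  have hτ0 : τ ≠ 0 := by intro h; simp [h] at hττ
  obtain ⟨z, -, hz⟩ := hH (p / τ ^ 2) (by rwa [map_div₀, hττ, div_one])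
  refine ⟨2 * (y - τ * z) - a, ?_⟩
  field_simp at hz
  have : (2 * (y - τ * z) - a) ^ 2 = τ ^ 2 + 4 * (τ ^ 2 * (z ^ 2 - z)) := by rw [hτ]; ring
  rw [this]
  have h2 : τ ^ 2 * (z ^ 2 - z) = -p := by linear_combination hz
  rw [h2, hτ, hp]
  ring

variable {E L : Type*} [Field E] [Field L] [Algebra E L] {v : Valuation E ℤᵐ⁰}
  {w : Valuation L ℤᵐ⁰}

open IsLocalRing Polynomial in
/-- A residue class of an unramified extension whose square comes from the base field comes from
the base field, if the residue characteristic is two. -/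
theorem exists_approx_of_sq (hwv : IsUnramifiedExtension v w) (h2 : v 2 < 1) {y : L} {b : E}
    (hb : v b ≤ 1) (hy : w y ≤ 1) (hyb : w (y ^ 2 + algebraMap E L b) < 1) :
    ∃ c : E, v c ≤ 1 ∧ w (y - algebraMap E L c) < 1 := by
  obtain ⟨-, hcomap, hext, hsep⟩ := hwv
  let y' : w.valuationSubring := ⟨y, hy⟩
  let b' : v.valuationSubring := ⟨b, hb⟩
  set ybar := residue w.valuationSubring y' with hybar
  set bbar := residue v.valuationSubring b' with hbbar
  have h2bar : (2 : ResidueField v.valuationSubring) = 0 := by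
    have h : residue v.valuationSubring 2 = 0 := by
      rw [residue_eq_zero_iff, Valuation.mem_maximalIdeal_iff]
      exact h2
    exact (map_ofNat (residue v.valuationSubring) 2).symm.trans h
  have hroot : ybar ^ 2 + algebraMap _ _ bbar = 0 := by
    have h : residue w.valuationSubring (y' ^ 2 + algebraMap _ _ b') = 0 := by
      rw [residue_eq_zero_iff, Valuation.mem_maximalIdeal_iff]
      exact hyb
    rw [_root_.map_add, map_pow] at h
    exact h
  set q : (ResidueField v.valuationSubring)[X] := X ^ 2 + C bbar with hq
  have hqm : q.Monic := by rw [hq]; monicity!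
  have hqd : q.natDegree = 2 := by rw [hq]; compute_degree!
  have hdvd : minpoly (ResidueField v.valuationSubring) ybar ∣ q := by
    apply minpoly.dvd
    simp [hq, hroot]
  have hint : IsIntegral (ResidueField v.valuationSubring) ybar := ⟨q, hqm, by simp [hq, hroot]⟩
  have hle := natDegree_le_of_dvd hdvd hqm.ne_zero
  have hpos := minpoly.natDegree_pos hint
  -- In characteristic two `X² + b̄` has zero derivative, so it cannot be the minimal polynomial of
  -- a separable element.
  have hne : (minpoly (ResidueField v.valuationSubring) ybar).natDegree ≠ 2 := by
    intro hd
    have heq : minpoly (ResidueField v.valuationSubring) ybar = q :=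
      (eq_of_monic_of_dvd_of_natDegree_le (minpoly.monic hint) hqm hdvd (by omega)).symm
    have hs : (minpoly (ResidueField v.valuationSubring) ybar).Separable :=
      Algebra.IsSeparable.isSeparable _ ybar
    rw [heq, Polynomial.Separable] at hs
    have hder : derivative q = 0 := by
      rw [hq, derivative_add, derivative_C, derivative_X_pow, add_zero]
      simp [h2bar]
    rw [hder, isCoprime_zero_right] at hs
    have := natDegree_eq_zero_of_isUnit hs
    omega
  have h1 : (minpoly (ResidueField v.valuationSubring) ybar).natDegree = 1 := by omega
  rw [minpoly.natDegree_eq_one_iff] at h1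
  obtain ⟨cbar, hc⟩ := h1
  obtain ⟨c', rfl⟩ := residue_surjective cbar
  refine ⟨c', c'.2, ?_⟩
  have h : residue w.valuationSubring (y' - algebraMap _ _ c') = 0 := by
    rw [_root_.map_sub, ← hybar, ← hc, sub_eq_zero]
    rfl
  rw [residue_eq_zero_iff, Valuation.mem_maximalIdeal_iff] at h
  exact h

/-- Suppose a residual root appears over `L`. If `δ` is not a unit, then neither is `a`, and the
root satisfies `ȳ² = -b̄`; by separability it would already lie in the residue field of `E`. So `δ`
is a unit and the root lifts. -/
theorem NoResidualRoot.map_or_exists_sqrt (hwv : IsUnramifiedExtension v w)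
    (hH : w.QuadraticHensel) (h2 : v 2 < 1) {a b : E} (h : v.NoResidualRoot a b) :
    w.NoResidualRoot (algebraMap E L a) (algebraMap E L b) ∨
      (v (a ^ 2 - 4 * b) = 1 ∧ ∃ η : L, η ^ 2 = algebraMap E L (a ^ 2 - 4 * b)) := by
  have hcomap : ∀ x : E, w (algebraMap E L x) = v x := fun x => by rw [← hwv.2.1]; rfl
  have hδle : v (a ^ 2 - 4 * b) ≤ 1 := by
    refine v.map_sub_le ?_ ?_
    · rw [map_pow]; exact pow_le_one₀ zero_le h.val_a_le
    · rw [show (4 : E) = 2 * 2 by norm_num, map_mul, map_mul]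
      exact mul_le_one' (mul_le_one' h2.le h2.le) h.val_b_le
  by_cases hex : ∃ y : L, w y ≤ 1 ∧ w (y ^ 2 - algebraMap E L a * y + algebraMap E L b) < 1
  · right
    obtain ⟨y, hy, hroot⟩ := hex
    rcases lt_or_eq_of_le hδle with hlt | heq
    · exfalso
      have ha : v a < 1 := by
        have h4 : v (4 * b) < 1 := by
          rw [show (4 : E) = 2 * 2 by norm_num, map_mul, map_mul]
          exact (mul_le_of_le_one_right' h.val_b_le).trans_lt
            ((mul_le_of_le_one_right' h2.le).trans_lt h2)
        have : v (a ^ 2) < 1 := by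
          have := v.map_add_lt hlt h4
          rwa [sub_add_cancel] at this
        rw [map_pow] at this
        exact (pow_lt_one_iff (by norm_num)).1 this
      have hay : w (algebraMap E L a * y) < 1 := by
        rw [map_mul, hcomap]; exact (mul_le_of_le_one_right' hy).trans_lt ha
      obtain ⟨c, hc, hyc⟩ := exists_approx_of_sq hwv h2 h.val_b_le hy (by
        have := w.map_add_lt hroot hay
        convert this using 2
        ring)
      have h1 := h.val_eq_one c hc
      rw [← hcomap] at h1
      refine absurd h1 (ne_of_lt ?_)
      have hid : algebraMap E L (c ^ 2 - a * c + b) =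
          (y ^ 2 - algebraMap E L a * y + algebraMap E L b) -
          (y - algebraMap E L c) * (y + algebraMap E L c - algebraMap E L a) := by
        simp only [_root_.map_add, _root_.map_sub, map_mul, map_pow]; ring
      rw [hid]
      refine w.map_sub_lt hroot ?_
      rw [map_mul]
      refine (mul_le_of_le_one_right' ?_).trans_lt hyc
      refine w.map_sub_le (w.map_add_le hy ?_) ?_
      · rwa [hcomap]
      · rw [hcomap]; exact h.val_a_le
    · refine ⟨heq, ?_⟩
      have hmap : algebraMap E L (a ^ 2 - 4 * b) =
          algebraMap E L a ^ 2 - 4 * algebraMap E L b := by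
        simp only [_root_.map_sub, map_mul, map_pow, map_ofNat]
      rw [hmap]
      refine exists_sqrt_disc_of_approx_root hH ?_ hroot
      rw [← hmap, hcomap, heq]
  · left
    push Not at hex
    have ha : w (algebraMap E L a) ≤ 1 := by rw [hcomap]; exact h.val_a_le
    have hb : w (algebraMap E L b) ≤ 1 := by rw [hcomap]; exact h.val_b_le
    refine ⟨ha, hb, fun y hy => le_antisymm ?_ (hex y hy)⟩
    refine w.map_add_le (w.map_sub_le ?_ ?_) hb
    · rw [map_pow]; exact pow_le_one₀ zero_le hy
    · rw [map_mul]; exact mul_le_one' ha hy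

end Valuation

/-! ### Bimodules from Brauer equivalences -/

section Bimodule

variable {E A C : Type*} [Field E] [Ring A] [Algebra E A] [Ring C] [Algebra E C]

/-- The action of matrices over an algebra on column vectors. -/
def matrixActionAlgHom (E A : Type*) [Field E] [Ring A] [Algebra E A] (n : ℕ) :
    Matrix (Fin n) (Fin n) A →ₐ[E] Module.End E (Fin n → A) :=
  AlgHom.ofLinearMap
    { toFun := fun M =>
        { toFun := M.mulVec
          map_add' := M.mulVec_add
          map_smul' := fun c v => M.mulVec_smul c v }
      map_add' := fun M N => LinearMap.ext fun v => Matrix.add_mulVec M N v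
      map_smul' := fun c M => LinearMap.ext fun v => Matrix.smul_mulVec c M v }
    (LinearMap.ext fun v => Matrix.one_mulVec v)
    (fun M N => LinearMap.ext fun v => (Matrix.mulVec_mulVec v M N).symm)

/-- Right multiplication on column vectors over an algebra. -/
def vectorMulRight (E A : Type*) [Field E] [Ring A] [Algebra E A] (n : ℕ) :
    A →ₗ[E] Module.End E (Fin n → A) where
  toFun a :=
    { toFun := fun v i => v i * a
      map_add' := fun _ _ => funext fun _ => add_mul _ _ _
      map_smul' := fun _ _ => funext fun _ => smul_mul_assoc _ _ _ }
  map_add' _ _ := LinearMap.ext fun _ => funext fun _ => mul_add _ _ _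
  map_smul' _ _ := LinearMap.ext fun _ => funext fun _ => mul_smul_comm _ _ _

theorem matrixActionAlgHom_vectorMulRight {n : ℕ} (M : Matrix (Fin n) (Fin n) A) (a : A)
    (v : Fin n → A) :
    matrixActionAlgHom E A n M (vectorMulRight E A n a v) =
      vectorMulRight E A n a (matrixActionAlgHom E A n M v) := by
  funext i
  change ∑ j, M i j * (v j * a) = (∑ j, M i j * v j) * a
  rw [Finset.sum_mul]
  exact Finset.sum_congr rfl fun j _ => (mul_assoc _ _ _).symm

/-- A Brauer equivalence between algebras of dimensions `4` and `N²` gives a bimodule of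
dimension `2N`. -/
theorem exists_bimodule_of_brauerEquivalent
    (h : BrauerEquivalent E A C) {N : ℕ} (hA : Module.finrank E A = 4)
    (hC : Module.finrank E C = N ^ 2) :
    ∃ (n : ℕ) (P : Submodule E (Fin n → A)) (ρ : C →ₐ[E] Module.End E P)
      (r : A →ₗ[E] Module.End E P), r 1 = 1 ∧ (∀ a b, r (a * b) = r b * r a) ∧
      (∀ c a p, ρ c (r a p) = r a (ρ c p)) ∧ Module.finrank E P = 2 * N := by
  obtain ⟨n, m, hn, hm, ⟨φ⟩⟩ := h
  obtain ⟨k, rfl⟩ := Nat.exists_eq_succ_of_ne_zero hm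
  have hdim := φ.toLinearEquiv.finrank_eq
  rw [Module.finrank_matrix, Module.finrank_matrix, hA, hC, Fintype.card_fin, Fintype.card_fin]
    at hdim
  let Ψ := (matrixActionAlgHom E A n).comp φ.symm.toAlgHom
  have hΨr : ∀ M a v, Ψ M (vectorMulRight E A n a v) = vectorMulRight E A n a (Ψ M v) :=
    fun M a v => matrixActionAlgHom_vectorMulRight _ _ _
  let ε : Fin (k + 1) → Fin (k + 1) → C → Matrix (Fin (k + 1)) (Fin (k + 1)) C :=
    fun i j c => Matrix.single i j c
  have hε : ∀ i j l c d v, Ψ (ε i j c) (Ψ (ε j l d) v) = Ψ (ε i l (c * d)) v := by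
    intro i j l c d v
    rw [← Module.End.mul_apply, ← map_mul, Matrix.single_mul_single_same]
  have hε0 : ∀ i j j' l c d v, j ≠ j' → Ψ (ε i j c) (Ψ (ε j' l d) v) = 0 := by
    intro i j j' l c d v hj
    rw [← Module.End.mul_apply, ← map_mul, Matrix.single_mul_single_of_ne _ _ _ _ hj, map_zero,
      LinearMap.zero_apply]
  -- Morita theory: transport the `Mₘ(C)`-action to `Aⁿ` and cut with the matrix unit `e₀₀`. The
  -- result is a `C`-module whose `m`-th power is `Aⁿ`, and right multiplication by `A` survives.
  let P : Submodule E (Fin n → A) := LinearMap.range (Ψ (ε 0 0 1))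
  have hP : ∀ p ∈ P, Ψ (ε 0 0 1) p = p := by
    rintro _ ⟨v, rfl⟩
    rw [hε, mul_one]
  have hmem : ∀ l c v, Ψ (ε 0 l c) v ∈ P := fun l c v => ⟨Ψ (ε 0 l c) v, by rw [hε, one_mul]⟩
  have hr : ∀ a, ∀ p ∈ P, vectorMulRight E A n a p ∈ P := by
    rintro a _ ⟨v, rfl⟩
    exact ⟨vectorMulRight E A n a v, hΨr _ _ _⟩
  let ρ : C →ₐ[E] Module.End E P := AlgHom.ofLinearMap
    { toFun := fun c => (Ψ (ε 0 0 c)).restrict fun v _ => hmem 0 c v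
      map_add' := fun c d => LinearMap.ext fun p => Subtype.ext (by
        simp [ε, Matrix.single_add])
      map_smul' := fun e c => LinearMap.ext fun p => Subtype.ext (by
        simp [ε, ← Matrix.smul_single]) }
    (LinearMap.ext fun p => Subtype.ext (hP p p.2))
    (fun c d => LinearMap.ext fun p => Subtype.ext (hε 0 0 0 c d p).symm)
  let r : A →ₗ[E] Module.End E P :=
    { toFun := fun a => (vectorMulRight E A n a).restrict (hr a)
      map_add' := fun c d => LinearMap.ext fun p => Subtype.ext (by simp)
      map_smul' := fun e c => LinearMap.ext fun p => Subtype.ext (by simp) }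
  have hsum : ∑ i, ε i i 1 = 1 := Matrix.sum_single_one
  have hequiv : (Fin n → A) ≃ₗ[E] (Fin (k + 1) → P) :=
    { toFun := fun v i => ⟨Ψ (ε 0 i 1) v, hmem i 1 v⟩
      map_add' := fun v w => funext fun i => Subtype.ext (map_add _ _ _)
      map_smul' := fun c v => funext fun i => Subtype.ext (map_smul _ _ _)
      invFun := fun p => ∑ i, Ψ (ε i 0 1) (p i)
      left_inv := fun v => by
        simp only [hε, mul_one]
        rw [← LinearMap.sum_apply, ← map_sum, hsum, map_one, Module.End.one_apply]
      right_inv := fun p => funext fun i => Subtype.ext (by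
        simp only [map_sum]
        rw [Finset.sum_eq_single i (fun j _ hj => hε0 _ _ _ _ _ _ _ hj.symm) (by simp), hε, mul_one,
          hP _ (p i).2]) }
  refine ⟨n, P, ρ, r, LinearMap.ext fun p => Subtype.ext (funext fun i => mul_one _),
    fun a b => LinearMap.ext fun p => Subtype.ext (funext fun i => (mul_assoc _ _ _).symm),
    fun c a p => Subtype.ext (hΨr _ _ _), ?_⟩
  have : FiniteDimensional E A := .of_finrank_pos (by omega)
  have hfr := hequiv.finrank_eq
  rw [Module.finrank_pi_fintype, Module.finrank_pi_fintype] at hfr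
  simp only [hA, Finset.sum_const, Finset.card_univ, Fintype.card_fin, smul_eq_mul] at hfr
  -- Comparing `dim Mₙ(A) = 4 n²` with `dim Mₘ(C) = m² N²` gives `2 n = m N`, while `m dim P = 4 n`.
  have h1 : (2 * n) ^ 2 = ((k + 1) * N) ^ 2 := by
    simp only [Nat.succ_eq_add_one] at hdim
    linear_combination hdim
  have h2 : 2 * n = (k + 1) * N := Nat.pow_left_injective (by norm_num : 2 ≠ 0) h1
  have h3 : (k + 1) * Module.finrank E P = (k + 1) * (2 * N) := by
    linear_combination 2 * h2 - hfr
  exact Nat.eq_of_mul_eq_mul_left (Nat.succ_pos k) h3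

end Bimodule

theorem IsCrossedProduct.finrank_eq {E L C : Type*} [Field E] [Field L] [Algebra E L]
    [FiniteDimensional E L] [IsGalois E L] [Ring C] [Algebra E C]
    {f : Gal(L/E) → Gal(L/E) → Lˣ} (h : IsCrossedProduct E L C f) :
    Module.finrank E C = Module.finrank E L ^ 2 := by
  obtain ⟨ι, u, -, -, hbij⟩ := h
  let e : (Gal(L/E) → L) →ₗ[E] C :=
    { toFun := fun x => ∑ σ, ι (x σ) * (u σ : C)
      map_add' := fun x y => by simp [add_mul, Finset.sum_add_distrib]
      map_smul' := fun c x => by simp [Finset.smul_sum] }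
  rw [← (LinearEquiv.ofBijective e hbij).finrank_eq, Module.finrank_pi_fintype, Finset.sum_const,
    Finset.card_univ, ← Nat.card_eq_fintype_card, IsGalois.card_aut_eq_finrank, smul_eq_mul, sq]

/-- If a quaternion algebra is Brauer equivalent to a crossed product, then the semilinear
operators of the crossed product act on a plane and commute there with the quaternion algebra. -/
theorem exists_twistedRepresentation {E L A C : Type*} [Field E] [Field L] [Algebra E L]
    [FiniteDimensional E L] [IsGalois E L] [Ring C] [Algebra E C] [Ring A] [Algebra E A]
    {f : Gal(L/E) → Gal(L/E) → Lˣ} (hf : IsCrossedProduct E L C f)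
    (h : BrauerEquivalent E A C) (hA : Module.finrank E A = 4) :
    ∃ (n : ℕ) (P : Submodule E (Fin n → A)) (_ : Module L P) (u : Gal(L/E) → P →+ P)
      (r : A →+ (P →ₗ[L] P)), IsTwistedRepresentation f u ∧
      (∀ x p, r (algebraMap E A x) p = algebraMap E L x • p) ∧
      (∀ a b p, r (a * b) p = r b (r a p)) ∧ (∀ σ a p, u σ (r a p) = r a (u σ p)) := by
  obtain ⟨n, P, ρ, r, hr1, hrmul, hcomm, hP⟩ := exists_bimodule_of_brauerEquivalent h hA
    hf.finrank_eq
  obtain ⟨ι, u, huι, huu, -⟩ := hf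
  let : Module L P := Module.compHom P (ρ.comp ι).toRingHom
  have hsmul : ∀ (l : L) (p : P), l • p = ρ (ι l) p := fun l p => rfl
  have halg : ∀ (x : E) (p : P), algebraMap E L x • p = x • p := fun x p => by
    rw [hsmul, AlgHom.commutes, AlgHom.commutes, Module.algebraMap_end_apply]
  have : IsScalarTower E L P := ⟨fun x l p => by
    rw [Algebra.smul_def, mul_smul, halg]⟩
  refine ⟨n, P, inferInstance, fun σ => (ρ (u σ)).toAddMonoidHom,
    { toFun := fun a =>
        { toFun := r a
          map_add' := map_add _
          map_smul' := fun l p => (hcomm _ _ _).symm }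
      map_zero' := LinearMap.ext fun p => LinearMap.congr_fun (map_zero r) p
      map_add' := fun a b => LinearMap.ext fun p => LinearMap.congr_fun (map_add r a b) p },
    ⟨fun σ l p => ?_, fun σ τ p => ?_, fun σ p hp => ?_, ?_⟩, fun x p => ?_, fun a b p => ?_,
    fun σ a p => hcomm _ _ _⟩
  · change ρ (u σ) (ρ (ι l) p) = ρ (ι (σ l)) (ρ (u σ) p)
    rw [← Module.End.mul_apply, ← map_mul, huι, map_mul, Module.End.mul_apply]
  · change ρ (u σ) (ρ (u τ) p) = ρ (ι (f σ τ)) (ρ (u (σ * τ)) p)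
    rw [← Module.End.mul_apply, ← map_mul, huu, map_mul, Module.End.mul_apply]
  · change ρ (u σ) p = 0 at hp
    have := congrArg (ρ ((u σ)⁻¹ : Cˣ)) hp
    rwa [← Module.End.mul_apply, ← map_mul, Units.inv_mul, map_one, map_zero] at this
  -- The `E`-dimension of the bimodule is `2 [L : E]`, so it is a plane over `L`.
  · have := Module.finrank_mul_finrank E L P
    rw [hP, mul_comm] at this
    exact Nat.eq_of_mul_eq_mul_right Module.finrank_pos this
  · change r (algebraMap E A x) p = algebraMap E L x • p
    rw [halg, Algebra.algebraMap_eq_smul_one, map_smul, hr1]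
    rfl
  · change r (a * b) p = r b (r a p)
    rw [hrmul]
    rfl

/-! ### Quaternion algebras without ramification over dyadic fields -/

/-- The local alternative for `(s, t₁ t₂)` supplies an operator on the twisted plane that makes the
valuation of the given cocycle a coboundary. The extension `L` is whichever one computes `χ`. -/
theorem ramification_eq_zero_of_dyadic {E : Type u} [Field E] [Valued E ℤᵐ⁰] [CompleteSpace E]
    (hv : Function.Surjective (Valued.v : Valuation E ℤᵐ⁰)) (h20 : (2 : E) ≠ 0)
    (h2 : (Valued.v : Valuation E ℤᵐ⁰) 2 < 1) {s t₁ t₂ : E} (hs : s ≠ 0) (ht₁ : t₁ ≠ 0)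
    (ht₂ : t₂ ≠ 0) (hrep : ∀ r : E, r ≠ 0 →
      (QuaternionPair.Represents s t₁ r ↔ QuaternionPair.Represents s t₂ r))
    {A : Type*} [Ring A] [Algebra E A] (hA : Nonempty (ℍ[E,s,0,t₁ * t₂] ≃ₐ[E] A))
    {L : Type u} [Field L] [Algebra E L] {w : Valuation L ℤᵐ⁰}
    {χ : Gal(L/E) → AddCircle (1 : ℚ)}
    (h : HasRamification (Valued.v : Valuation E ℤᵐ⁰) A w χ) : χ = 0 := by
  obtain ⟨hwv, hgal, hfin, C, _, _, f, hf, hbr, rfl⟩ := h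
  obtain ⟨hinv, hHw⟩ := Valuation.invariant_and_quadraticHensel hv hwv.2.1
  have h2L : (2 : L) ≠ 0 := by
    rw [← map_ofNat (algebraMap E L) 2]
    exact (map_ne_zero _).2 h20
  have hcomap : ∀ x : E, w (algebraMap E L x) = Valued.v x := fun x => by rw [← hwv.2.1]; rfl
  obtain ⟨e₀⟩ := hA
  have hfA : Module.finrank E A = 4 := by
    rw [← e₀.toLinearEquiv.finrank_eq, QuaternionAlgebra.finrank_eq_four]
  obtain ⟨n, P, _, u, r, hu, hralg, hrmul, hru⟩ := exists_twistedRepresentation hf hbr hfA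
  have hrsub : ∀ x y p, r (x - y) p = r x p - r y p := fun x y p => by
    rw [eq_sub_iff_add_eq, ← LinearMap.add_apply, ← map_add, sub_add_cancel]
  have hrneg : ∀ x p, r (-x) p = -r x p := fun x p => by
    rw [← zero_sub, hrsub, map_zero, LinearMap.zero_apply, zero_sub]
  suffices ∃ g : Gal(L/E) → ℤ, ∀ σ τ, WithZero.log (w (f σ τ)) = g σ + g τ - g (σ * τ) by
    obtain ⟨g, hg⟩ := this
    exact ramificationCharacter_eq_zero_of_coboundary hg
  have hsqrt : ∀ {δ t : E} {η : L}, QuaternionPair.Iso s (t₁ * t₂) δ t → η ≠ 0 →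
      η ^ 2 = algebraMap E L δ → t ≠ 0 → IsSquare ((Valued.v : Valuation E ℤᵐ⁰) t) →
      ∃ g : Gal(L/E) → ℤ, ∀ σ τ, WithZero.log (w (f σ τ)) = g σ + g τ - g (σ * τ) := by
    rintro δ t η ⟨e⟩ hη hηδ ht hvt
    let φ := e.symm.trans e₀
    refine hu.exists_coboundary_of_sqrt h2L hinv (r (φ ⟨0, 1, 0, 0⟩)) (r (φ ⟨0, 0, 1, 0⟩)) hη hηδ ht
      (by rwa [hcomap]) (fun p => ?_) (fun p => ?_) (fun p => ?_) (fun σ p => hru _ _ _)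
      (fun σ p => hru _ _ _)
    · rw [← hrmul, ← hralg, ← map_mul, ← AlgEquiv.commutes φ]
      congr 3
      ext <;> simp [QuaternionAlgebra.algebraMap_eq]
    · rw [← hrmul, ← hralg, ← map_mul, ← AlgEquiv.commutes φ]
      congr 3
      ext <;> simp [QuaternionAlgebra.algebraMap_eq]
    · rw [← hrmul, ← hrmul, ← map_mul, ← map_mul, ← hrneg, ← map_neg]
      congr 3
      ext <;> simp
  rcases Valuation.split_or_exists_noResidualRoot h20 hv (Valuation.quadraticHensel_of_complete hv)
    hs ht₁ ht₂ hrep with h1 | ⟨a, b, t, hab, ht, hiso, hsq⟩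
  -- The split algebra is `(1, 1)`, treated as `δ = t = 1`.
  · exact hsqrt h1 (η := 1) one_ne_zero (by simp) one_ne_zero (by simp)
  · rcases hab.map_or_exists_sqrt hwv hHw h2 with hab' | ⟨hδ, η, hη⟩
    · obtain ⟨e⟩ := hiso
      let φ := e.symm.trans e₀
      -- The quaternion `(a + i)/2` with `i² = δ` is a root of `X² - aX + b`.
      refine hu.exists_coboundary_of_noResidualRoot hinv (r (φ ⟨a / 2, 1 / 2, 0, 0⟩))
        (fun p => ?_) (fun σ p => hru _ _ _) hab'
      rw [← hrmul, ← map_mul, ← hralg, ← hralg, ← hrmul, ← hrsub]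
      congr 2
      rw [← AlgEquiv.commutes φ, ← AlgEquiv.commutes φ, ← map_mul, ← map_sub]
      congr 1
      ext <;> simp [QuaternionAlgebra.algebraMap_eq] <;> field_simp <;> ring
    · exact hsqrt hiso (by rintro rfl; rw [zero_pow two_ne_zero] at hη
                           exact hab.disc_ne_zero h20 ((map_eq_zero _).1 hη.symm)) hη ht (hsq hδ)

/-! ### Quaternion algebras without ramification over nondyadic fields -/

theorem isSeparable_residueField_of_surjective {E L : Type*} [Field E] [Field L] [Algebra E L]
    (v : Valuation E ℤᵐ⁰) (w : Valuation L ℤᵐ⁰) [v.HasExtension w]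
    (h : Function.Surjective (algebraMap E L)) :
    Algebra.IsSeparable (IsLocalRing.ResidueField v.valuationSubring)
      (IsLocalRing.ResidueField w.valuationSubring) := by
  refine ⟨fun x => ?_⟩
  obtain ⟨⟨y, hy⟩, rfl⟩ := IsLocalRing.residue_surjective x
  obtain ⟨z, rfl⟩ := h y
  exact isSeparable_algebraMap (IsLocalRing.residue v.valuationSubring
    ⟨z, (Valuation.HasExtension.val_map_le_one_iff v w z).1 hy⟩)

/-- The trivial extension `E / E` with the trivial cocycle represents the split class. -/
theorem QuaternionPair.ramificationZero_of_split {E : Type u} [Field E] (h2 : (2 : E) ≠ 0)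
    (v : Valuation E ℤᵐ⁰) {A : Type*} [Ring A] [Algebra E A]
    (hA : Nonempty (ℍ[E,1,0,1] ≃ₐ[E] A)) : RamificationZero v A := by
  obtain ⟨e⟩ := hA
  obtain ⟨e'⟩ := QuaternionPair.matrix_equiv h2
  refine ⟨E, inferInstance, inferInstance, v, _, ⟨⟨inferInstance, rfl, inferInstance,
    isSeparable_residueField_of_surjective v v Function.surjective_id⟩,
    IsGalois.self E, inferInstance, E, inferInstance, inferInstance, fun _ _ => 1,
    ⟨AlgHom.id E E, fun _ => 1, fun σ x => ?_, fun σ τ => by simp, ?_, ?_⟩,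
    ⟨1, 1 * 2, one_ne_zero, two_ne_zero, ⟨((e.symm.trans e').mapMatrix.trans
      (Matrix.compAlgEquiv _ _ E E)).trans (Matrix.reindexAlgEquiv E E finProdFinEquiv)⟩⟩, rfl⟩, ?_⟩
  · rw [Subsingleton.elim σ 1]
    simp
  · intro x y hxy
    funext σ
    simpa [Fintype.sum_subsingleton _ σ] using hxy
  · intro y
    exact ⟨fun _ => y, by simp [Fintype.sum_subsingleton _ (1 : Gal(E/E))]⟩
  · exact ramificationCharacter_eq_zero_of_coboundary (g := 0) fun σ τ => by simp

namespace Valuation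

/-! ### Unramified quadratic extensions -/

section Quadratic

variable {E : Type*} [Field E] {v : Valuation E ℤᵐ⁰} {δ : E}

theorem NoResidualRoot.val_sq_sub (h : v.NoResidualRoot 0 (-δ)) (x y : E) :
    v (x ^ 2 - δ * y ^ 2) = max (v x) (v y) ^ 2 := by
  have hδ : v δ = 1 := by simpa using h.val_b
  rcases le_or_gt (v x) (v y) with hxy | hxy
  · rw [max_eq_right hxy]
    by_cases hy : y = 0
    · subst hy
      have hx : x = 0 := by simpa using hxy
      simp [hx]
    · have h1 := h.val_eq_one (x / y) (by
        rw [map_div₀]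
        exact div_le_one_of_le₀ hxy zero_le)
      have h2 : x ^ 2 - δ * y ^ 2 = y ^ 2 * ((x / y) ^ 2 - 0 * (x / y) + -δ) := by
        field_simp; ring
      rw [h2, map_mul, h1, map_pow, mul_one]
  · rw [max_eq_left hxy.le, v.map_sub_eq_of_lt_left, map_pow]
    rw [map_mul, hδ, one_mul, map_pow, map_pow]
    exact pow_lt_pow_left₀ hxy zero_le two_ne_zero

/-- The Gauss valuation on an unramified quadratic extension. -/
def quadraticExtension (h : v.NoResidualRoot 0 (-δ)) : Valuation (QuadraticAlgebra E δ 0) ℤᵐ⁰ where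
  toFun z := max (v z.re) (v z.im)
  map_zero' := by simp
  map_one' := by
    change max (v 1) (v 0) = 1
    simp
  map_mul' z z' := by
    -- The square of the Gauss value is the value of the norm, which is multiplicative.
    refine (pow_left_inj₀ zero_le zero_le two_ne_zero).1 ?_
    rw [mul_pow, ← h.val_sq_sub, ← h.val_sq_sub, ← h.val_sq_sub, ← map_mul]
    congr 1
    simp only [QuadraticAlgebra.re_mul, QuadraticAlgebra.im_mul]
    ring
  map_add_le_max' z z' := by
    refine max_le ?_ ?_
    · refine (v.map_add _ _).trans (max_le_max (le_max_left _ _) (le_max_left _ _))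
    · refine (v.map_add _ _).trans (max_le_max (le_max_right _ _) (le_max_right _ _))

theorem quadraticExtension_apply (h : v.NoResidualRoot 0 (-δ)) (z : QuadraticAlgebra E δ 0) :
    quadraticExtension h z = max (v z.re) (v z.im) := rfl

theorem NoResidualRoot.fact (h : v.NoResidualRoot 0 (-δ)) :
    Fact (∀ r : E, r ^ 2 ≠ δ + 0 * r) := by
  refine ⟨fun r hr => ?_⟩
  have := h.val_sq_sub r 1
  rw [show r ^ 2 - δ * 1 ^ 2 = 0 by rw [hr]; ring, map_zero, map_one] at this
  have h1 : (1 : ℤᵐ⁰) ≤ max (v r) 1 := le_max_right _ _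
  have h2 : max (v r) 1 = 0 := by simpa using this.symm
  rw [h2] at h1
  simp at h1

-- The residue extension is generated by a root of `X² - δ̄`, separable because `2` and `δ` are
-- units.
open IsLocalRing in
theorem isUnramifiedExtension_quadratic (h : v.NoResidualRoot 0 (-δ)) (h2 : v 2 = 1)
    [Fact (∀ r : E, r ^ 2 ≠ δ + 0 * r)] :
    IsUnramifiedExtension v (quadraticExtension h) := by
  have hcomap : (quadraticExtension h).comap (algebraMap E (QuadraticAlgebra E δ 0)) = v := by
    ext x
    rw [comap_apply, quadraticExtension_apply]
    simp
  have hext : v.HasExtension (quadraticExtension h) := ⟨by rw [hcomap]; exact .refl⟩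
  refine ⟨.of_finrank_pos (by rw [QuadraticAlgebra.finrank_eq_two]; norm_num), hcomap, hext,
    ⟨fun x => ?_⟩⟩
  have hδ : v δ = 1 := by simpa using h.val_b
  have hres : ∀ y : v.valuationSubring, v y = 1 → residue v.valuationSubring y ≠ 0 := by
    intro y hy h0
    rw [residue_eq_zero_iff, Valuation.mem_maximalIdeal_iff, hy] at h0
    exact lt_irrefl _ h0
  obtain ⟨z, rfl⟩ := residue_surjective x
  have hz : max (v z.1.re) (v z.1.im) ≤ 1 := z.2
  let c : v.valuationSubring := ⟨z.1.re, (le_max_left _ _).trans hz⟩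
  let d : v.valuationSubring := ⟨z.1.im, (le_max_right _ _).trans hz⟩
  let δ' : v.valuationSubring := ⟨δ, hδ.le⟩
  let ω' : (quadraticExtension h).valuationSubring := ⟨QuadraticAlgebra.omega, by
    change max (v 0) (v 1) ≤ 1
    simp⟩
  have hzcd : z = algebraMap _ _ c + ω' * algebraMap _ _ d := by
    refine Subtype.ext ?_
    change z.1 = algebraMap E _ z.1.re + QuadraticAlgebra.omega * algebraMap E _ z.1.im
    ext <;> simp
  have hω : residue _ ω' ^ 2 = algebraMap _ _ (residue v.valuationSubring δ') := by
    have : ω' ^ 2 = algebraMap _ _ δ' := by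
      refine Subtype.ext ?_
      change QuadraticAlgebra.omega ^ 2 = algebraMap E _ δ
      rw [sq]
      ext <;> simp
    rw [← map_pow, this]
    rfl
  have hsep : IsSeparable (ResidueField v.valuationSubring) (residue _ ω') := by
    refine (Polynomial.separable_X_pow_sub_C (n := 2) (residue v.valuationSubring δ') ?_
      (hres _ hδ)).of_dvd (minpoly.dvd _ _ ?_)
    · have := hres 2 h2
      exact this
    · simp [hω]
  rw [hzcd, _root_.map_add, map_mul]
  exact Field.isSeparable_add (isSeparable_algebraMap (residue _ c))
    (Field.isSeparable_mul hsep (isSeparable_algebraMap (residue _ d)))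

end Quadratic

end Valuation

/-! ### Quaternion algebras as crossed products -/

section CrossedProduct

variable {E : Type*} [Field E] {δ : E} [Fact (∀ r : E, r ^ 2 ≠ δ + 0 * r)]

/-- The nontrivial automorphism of a quadratic extension. -/
def QuadraticAlgebra.conjugation (E : Type*) [Field E] (δ : E)
    [Fact (∀ r : E, r ^ 2 ≠ δ + 0 * r)] : Gal((QuadraticAlgebra E δ 0)/E) where
  toFun z := ⟨z.re, -z.im⟩
  invFun z := ⟨z.re, -z.im⟩
  left_inv z := by simp
  right_inv z := by simp
  map_mul' z z' := by
    ext
    · simp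
    · simp; ring
  map_add' z z' := by ext <;> simp; ring
  commutes' z := by ext <;> simp

theorem QuadraticAlgebra.conjugation_ne_one (h2 : (2 : E) ≠ 0) : conjugation E δ ≠ 1 := by
  intro h
  have h1 : (conjugation E δ omega).im = (omega : QuadraticAlgebra E δ 0).im := by rw [h]; rfl
  have h3 : (-1 : E) = 1 := h1
  exact h2 (by linear_combination -h3)

theorem QuadraticAlgebra.eq_one_or_eq_conjugation (τ : Gal((QuadraticAlgebra E δ 0)/E)) :
    τ = 1 ∨ τ = conjugation E δ := by
  have hω : (omega : QuadraticAlgebra E δ 0) * omega = algebraMap E _ δ := by ext <;> simp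
  have h : (τ omega - omega) * (τ omega + omega) = 0 := by
    have : τ omega * τ omega = omega * omega := by rw [← map_mul, hω, AlgEquiv.commutes]
    linear_combination this
  have hext : ∀ τ' : Gal((QuadraticAlgebra E δ 0)/E), τ omega = τ' omega → τ = τ' := by
    intro τ' h'
    have : (τ : QuadraticAlgebra E δ 0 →ₐ[E] QuadraticAlgebra E δ 0) = τ' := algHom_ext h'
    exact AlgEquiv.ext fun x => congrArg (fun f => f x) this
  rcases mul_eq_zero.1 h with h | h
  · exact Or.inl (hext _ (sub_eq_zero.1 h))
  · refine Or.inr (hext _ ?_)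
    rw [eq_neg_of_add_eq_zero_left h]
    ext <;> simp [conjugation]

end CrossedProduct

namespace QuaternionPair

section CrossedProduct

open QuadraticAlgebra (conjugation)

variable {E : Type*} [Field E] {δ : E} [Fact (∀ r : E, r ^ 2 ≠ δ + 0 * r)]

theorem isGalois_quadraticAlgebra (h2 : (2 : E) ≠ 0) :
    IsGalois E (QuadraticAlgebra E δ 0) := by
  have hfr := QuadraticAlgebra.finrank_eq_two δ (0 : E)
  have : FiniteDimensional E (QuadraticAlgebra E δ 0) := .of_finrank_pos (by rw [hfr]; norm_num)
  refine .of_card_aut_eq_finrank _ _ ?_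
  rw [hfr, Nat.card_eq_two_iff]
  refine ⟨1, conjugation E δ, (QuadraticAlgebra.conjugation_ne_one h2).symm, ?_⟩
  ext τ
  simpa using QuadraticAlgebra.eq_one_or_eq_conjugation τ

open Classical in
/-- The cocycle on the Galois group of a quadratic extension defined by a scalar. -/
noncomputable def quadraticCocycle (δ : E) [Fact (∀ r : E, r ^ 2 ≠ δ + 0 * r)] (t : Eˣ)
    (σ τ : Gal((QuadraticAlgebra E δ 0)/E)) : (QuadraticAlgebra E δ 0)ˣ :=
  if σ = 1 ∨ τ = 1 then 1 else Units.map (algebraMap E (QuadraticAlgebra E δ 0)) t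

/-- A quaternion algebra as a crossed product. -/
theorem isCrossedProduct (h2 : (2 : E) ≠ 0) [FiniteDimensional E (QuadraticAlgebra E δ 0)]
    (t : Eˣ) : IsCrossedProduct E (QuadraticAlgebra E δ 0) ℍ[E,δ,0,(t : E)]
      (quadraticCocycle δ t) := by
  classical
  have hne := QuadraticAlgebra.conjugation_ne_one (δ := δ) h2
  let ι : QuadraticAlgebra E δ 0 →ₐ[E] ℍ[E,δ,0,(t : E)] :=
    QuadraticAlgebra.lift ⟨⟨0, 1, 0, 0⟩, by ext <;> simp⟩
  have hι : ∀ z, ι z = ⟨z.re, z.im, 0, 0⟩ := by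
    intro z
    ext <;> simp [ι, QuadraticAlgebra.lift]
  let j : (ℍ[E,δ,0,(t : E)])ˣ :=
    ⟨⟨0, 0, 1, 0⟩, ⟨0, 0, (t : E)⁻¹, 0⟩, by ext <;> simp, by ext <;> simp⟩
  let u : Gal((QuadraticAlgebra E δ 0)/E) → (ℍ[E,δ,0,(t : E)])ˣ := fun σ => if σ = 1 then 1 else j
  have hj : (j : ℍ[E,δ,0,(t : E)]) = ⟨0, 0, 1, 0⟩ := rfl
  have hu1 : u 1 = 1 := by simp [u]
  have hu : u (conjugation E δ) = j := by simp [u, hne]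
  have hcc : conjugation E δ * conjugation E δ = 1 := by
    ext z <;> simp [conjugation]
  refine ⟨ι, u, fun σ x => ?_, fun σ τ => ?_, ?_⟩
  · rcases QuadraticAlgebra.eq_one_or_eq_conjugation σ with rfl | rfl
    · simp [hu1]
    · rw [hu, hι, hι, hj]
      ext <;> simp [conjugation]
  · rcases QuadraticAlgebra.eq_one_or_eq_conjugation σ with rfl | rfl
    · simp [hu1, quadraticCocycle]
    · rcases QuadraticAlgebra.eq_one_or_eq_conjugation τ with rfl | rfl
      · simp [hu1, quadraticCocycle]
      · rw [hcc, hu1, hu, quadraticCocycle, if_neg (by simp [hne]), hι, hj]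
        ext <;> simp
  · have huniv : (Finset.univ : Finset Gal((QuadraticAlgebra E δ 0)/E)) = {1, conjugation E δ} := by
      ext τ
      simpa using QuadraticAlgebra.eq_one_or_eq_conjugation τ
    have hsum : ∀ x : Gal((QuadraticAlgebra E δ 0)/E) → QuadraticAlgebra E δ 0,
        ∑ σ, ι (x σ) * (u σ : ℍ[E,δ,0,(t : E)]) =
        ⟨(x 1).re, (x 1).im, (x (conjugation E δ)).re, (x (conjugation E δ)).im⟩ := by
      intro x
      rw [huniv, Finset.sum_pair hne.symm, hu1, hu, hι, hι, hj]
      ext <;> simp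
    constructor
    · intro x y hxy
      simp only [hsum, QuaternionAlgebra.mk.injEq] at hxy
      funext τ
      rcases QuadraticAlgebra.eq_one_or_eq_conjugation τ with rfl | rfl
      · exact QuadraticAlgebra.ext hxy.1 hxy.2.1
      · exact QuadraticAlgebra.ext hxy.2.2.1 hxy.2.2.2
    · intro q
      refine ⟨fun τ => if τ = 1 then ⟨q.re, q.imI⟩ else ⟨q.imJ, q.imK⟩, ?_⟩
      simp [hsum, hne]

end CrossedProduct

/-- The algebra is itself a crossed product over the unramified `E(√δ)`, with a cocycle taking unit
values. -/
theorem ramificationZero_of_noResidualRoot {E : Type u} [Field E] {v : Valuation E ℤᵐ⁰}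
    (h2 : v 2 = 1) {δ t : E} (h : v.NoResidualRoot 0 (-δ)) (ht : v t = 1) {A : Type*} [Ring A]
    [Algebra E A] (hA : Nonempty (ℍ[E,δ,0,t] ≃ₐ[E] A)) : RamificationZero v A := by
  obtain ⟨e⟩ := hA
  have h20 : (2 : E) ≠ 0 := v.ne_zero_iff.1 (by rw [h2]; exact one_ne_zero)
  have ht0 : t ≠ 0 := v.ne_zero_iff.1 (by rw [ht]; exact one_ne_zero)
  have := h.fact
  have hun := Valuation.isUnramifiedExtension_quadratic h h2
  have := hun.1
  refine ⟨QuadraticAlgebra E δ 0, inferInstance, inferInstance, Valuation.quadraticExtension h, _,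
    ⟨hun, isGalois_quadraticAlgebra h20, hun.1, ℍ[E,δ,0,t], inferInstance, inferInstance,
      quadraticCocycle δ (Units.mk0 t ht0), isCrossedProduct h20 (Units.mk0 t ht0),
      ⟨1, 1, one_ne_zero, one_ne_zero, ⟨e.symm.mapMatrix⟩⟩, rfl⟩, ?_⟩
  refine ramificationCharacter_eq_zero_of_coboundary (g := 0) fun σ τ => ?_
  have : Valuation.quadraticExtension h (quadraticCocycle δ (Units.mk0 t ht0) σ τ) = 1 := by
    unfold quadraticCocycle
    split_ifs
    · simp
    · rw [Valuation.quadraticExtension_apply]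
      simp [ht]
  simp [this]

theorem ramificationZero_of_nondyadic {E : Type u} [Field E] {v : Valuation E ℤᵐ⁰}
    (hv : Function.Surjective v) (hH : v.QuadraticHensel) (h2 : v 2 = 1) {s t₁ t₂ : E}
    (hs : s ≠ 0) (ht₁ : t₁ ≠ 0) (ht₂ : t₂ ≠ 0)
    (hrep : ∀ r : E, r ≠ 0 → (Represents s t₁ r ↔ Represents s t₂ r)) {A : Type*} [Ring A]
    [Algebra E A] (hA : Nonempty (ℍ[E,s,0,t₁ * t₂] ≃ₐ[E] A)) : RamificationZero v A := by
  obtain ⟨e⟩ := hA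
  have h20 : (2 : E) ≠ 0 := v.ne_zero_iff.1 (by rw [h2]; exact one_ne_zero)
  have h4 : v 4 = 1 := by rw [show (4 : E) = 2 * 2 by norm_num, map_mul, h2, one_mul]
  rcases Valuation.split_or_exists_noResidualRoot h20 hv hH hs ht₁ ht₂ hrep with
    ⟨⟨e'⟩⟩ | ⟨a, b, t, hab, ht, hiso, hsq⟩
  · exact ramificationZero_of_split h20 v ⟨e'.symm.trans e⟩
  have hhalf : ∀ y, v (y / 2) = v y := fun y => by rw [map_div₀, h2, div_one]
  -- As `2` is a unit, completing the square replaces `X² - aX + b` by `X² - δ`; in particular `δ`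
  -- is a unit.
  have hnr : v.NoResidualRoot 0 (-(a ^ 2 - 4 * b)) := by
    have key : ∀ y, v y ≤ 1 → v (y ^ 2 - 0 * y + -(a ^ 2 - 4 * b)) = 1 := by
      intro y hy
      have h1 := hab.val_eq_one ((y + a) / 2) (by
        rw [hhalf]
        exact v.map_add_le hy hab.val_a_le)
      have h5 : y ^ 2 - 0 * y + -(a ^ 2 - 4 * b) =
          4 * (((y + a) / 2) ^ 2 - a * ((y + a) / 2) + b) := by
        field_simp; ring
      rw [h5, map_mul, h4, h1, one_mul]
    refine ⟨by simp, ?_, key⟩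
    have := key 0 (by simp)
    rw [show (0 : E) ^ 2 - 0 * 0 + -(a ^ 2 - 4 * b) = -(a ^ 2 - 4 * b) by ring] at this
    exact this.le
  have hδ : v (a ^ 2 - 4 * b) = 1 := by rw [← v.map_neg]; exact hnr.val_b
  obtain ⟨γ, hγ⟩ := hsq hδ
  obtain ⟨c, rfl⟩ := hv γ
  have hc : c ≠ 0 := by
    rintro rfl
    rw [map_zero, mul_zero] at hγ
    exact v.ne_zero_iff.2 ht hγ
  -- `t` has even value, so a square factor makes it a unit.
  have ht' : t / c ^ 2 ≠ 0 := div_ne_zero ht (pow_ne_zero 2 hc)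
  obtain ⟨e'⟩ := hiso.trans (iso_mul_norm_right h20 (hab.disc_ne_zero h20) ht'
    (x := c⁻¹) (y := 0) (by field_simp; ring))
  refine ramificationZero_of_noResidualRoot h2 hnr ?_ ⟨e'.symm.trans e⟩
  rw [map_div₀, map_pow, hγ, ← sq, div_self]
  exact pow_ne_zero 2 (v.ne_zero_iff.2 hc)

end QuaternionPair

/-! ### Completions -/

theorem isDyadic_iff {F : Type*} [Field F] (v : Valuation F ℤᵐ⁰) : IsDyadic v ↔ v 2 < 1 := by
  have h : v 2 < 1 ↔ (2 : IsLocalRing.ResidueField v.valuationSubring) = 0 := by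
    rw [← map_ofNat (IsLocalRing.residue v.valuationSubring) 2, IsLocalRing.residue_eq_zero_iff,
      Valuation.mem_maximalIdeal_iff]
    rfl
  rw [h, IsDyadic]
  constructor
  · intro h
    have := ringChar.of_eq h
    exact_mod_cast CharP.cast_eq_zero (IsLocalRing.ResidueField v.valuationSubring) 2
  · intro h
    exact CharP.ringChar_of_prime_eq_zero Nat.prime_two (by exact_mod_cast h)

section Completion

variable {F : Type*} [Field F] (v : Valuation F ℤᵐ⁰)

theorem completionValuation_algebraMap (x : F) :
    completionValuation v (algebraMap F v.Completion x) = v x := by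
  change Valued.v ((WithVal.toVal v x : WithVal v) : v.Completion) = v x
  rw [Valued.valuedCompletion_apply]
  rfl

theorem denseRange_algebraMap_completion : DenseRange (algebraMap F v.Completion) :=
  UniformSpace.Completion.denseRange_coe.comp (WithVal.equiv v).symm.surjective.denseRange
    (by fun_prop)

theorem completionValuation_surjective {v : Valuation F ℤᵐ⁰} (hv : Function.Surjective v) :
    Function.Surjective (completionValuation v) := fun γ => by
  obtain ⟨x, rfl⟩ := hv γ
  exact ⟨_, completionValuation_algebraMap v x⟩

/-- `r' / r` is `1 + 4 z` with `v z < 1`, which equals `(1 - 2 y)²` for a root of `y² - y = z`. -/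
theorem Valuation.QuadraticHensel.exists_sq_mul {E : Type*} [Field E] {v : Valuation E ℤᵐ⁰}
    (hH : v.QuadraticHensel) {r r' : E} (h : v (r' - r) < v (4 * r)) :
    ∃ c : E, r' = c ^ 2 * r := by
  have hr : 4 * r ≠ 0 := by
    intro h0
    rw [h0, map_zero] at h
    exact not_lt_zero h
  obtain ⟨y, -, hy⟩ := hH (-((r' - r) / (4 * r))) (by
    rw [Valuation.map_neg, map_div₀]
    exact (div_lt_one₀ (v.pos_iff.2 hr)).2 h)
  refine ⟨1 - 2 * y, ?_⟩
  have hdiv : (r' - r) / (4 * r) * (4 * r) = r' - r := div_mul_cancel₀ _ hr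
  linear_combination -hdiv - 4 * r * hy

/-! ### Pure norm forms over completions -/

namespace QuaternionPair

theorem represents_map {F E : Type*} [Field F] [Field E] [Algebra F E] {s t r : F}
    (h : Represents s t r) :
    Represents (algebraMap F E s) (algebraMap F E t) (algebraMap F E r) := by
  obtain ⟨a, b, c, rfl⟩ := h
  exact ⟨algebraMap F E a, algebraMap F E b, algebraMap F E c, by simp [pureSq]⟩

theorem represents_sq_mul {F : Type*} [Field F] {s t r c : F} (hc : c ≠ 0)
    (h : Represents s t (c ^ 2 * r)) : Represents s t r := by
  obtain ⟨x, y, z, hxyz⟩ := h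
  refine ⟨x / c, y / c, z / c, ?_⟩
  simp only [pureSq] at hxyz ⊢
  field_simp
  linear_combination hxyz

/-- An inclusion between the sets of nonzero values of pure norm forms passes to completions. -/
theorem represents_of_denseRange {F E : Type*} [Field F] [Field E] [Valued E ℤᵐ⁰] [CompleteSpace E]
    [Algebra F E] (hd : DenseRange (algebraMap F E))
    (hv : Function.Surjective (Valued.v : Valuation E ℤᵐ⁰)) (h2 : (2 : F) ≠ 0) {s t₁ t₂ : F}
    (hrep : ∀ r : F, r ≠ 0 → Represents s t₁ r → Represents s t₂ r) {r : E}
    (hr : r ≠ 0) (h : Represents (algebraMap F E s) (algebraMap F E t₁) r) :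
    Represents (algebraMap F E s) (algebraMap F E t₂) r := by
  have h2' : (2 : E) ≠ 0 := by
    rw [← map_ofNat (algebraMap F E) 2]
    exact (map_ne_zero _).2 h2
  have h4 : (4 : E) = 2 * 2 := by norm_num
  have h40 : (4 : E) ≠ 0 := by rw [h4]; exact mul_ne_zero h2' h2'
  obtain ⟨a, b, c, habc⟩ := h
  let g : E × E × E → E := fun x =>
    pureSq (algebraMap F E s) (algebraMap F E t₁) x.1 x.2.1 x.2.2 - r
  have hg : Continuous g := by
    unfold g pureSq
    fun_prop
  -- Approximating the coordinates from `F` moves the value by less than `4 r`, hence only by a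
  -- square factor; the hypothesis over `F` then applies to the approximation.
  have hopen := (Valued.isOpen_ball E
    ((Valued.v : Valuation E ℤᵐ⁰).restrict (4 * r))).preimage hg
  obtain ⟨⟨a', b', c'⟩, hx⟩ := (hd.prodMap (hd.prodMap hd)).exists_mem_open hopen
    ⟨(a, b, c), by
      change (Valued.v : Valuation E ℤᵐ⁰).restrict (g (a, b, c)) < _
      rw [Valuation.restrict_lt_iff]
      simp only [g]
      rw [habc, sub_self, map_zero]
      exact (Valuation.pos_iff _).2 (mul_ne_zero h40 hr)⟩
  have hlt : (Valued.v : Valuation E ℤᵐ⁰) (algebraMap F E (pureSq s t₁ a' b' c') - r) <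
      (Valued.v : Valuation E ℤᵐ⁰) (4 * r) := by
    have := (Valuation.restrict_lt_iff _).1 hx
    simpa [g, pureSq] using this
  obtain ⟨e, he⟩ := (Valuation.quadraticHensel_of_complete hv).exists_sq_mul hlt
  have hne : pureSq s t₁ a' b' c' ≠ 0 := by
    intro h0
    rw [h0, map_zero, zero_sub, Valuation.map_neg, map_mul] at hlt
    refine not_lt_of_ge (mul_le_of_le_one_left' ?_) hlt
    rw [h4, map_mul]
    exact mul_le_one' Valuation.val_two_le Valuation.val_two_le
  have he0 : e ≠ 0 := by
    rintro rfl
    rw [zero_pow two_ne_zero, zero_mul] at he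
    exact hne ((map_eq_zero _).1 he)
  refine represents_sq_mul he0 ?_
  rw [← he]
  exact represents_map (hrep _ hne ⟨a', b', c', rfl⟩)

section BaseChange

variable {F : Type*} {E : Type u} [Field F] [Field E] [Valued E ℤᵐ⁰] [CompleteSpace E] [Algebra F E]
  {s t₁ t₂ : F}

theorem ramificationZero_tensor (hd : DenseRange (algebraMap F E))
    (hv : Function.Surjective (Valued.v : Valuation E ℤᵐ⁰)) (h2 : (2 : F) ≠ 0)
    (hs : s ≠ 0) (ht₁ : t₁ ≠ 0) (ht₂ : t₂ ≠ 0)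
    (hrep : ∀ r : F, r ≠ 0 → (Represents s t₁ r ↔ Represents s t₂ r))
    (hv2 : (Valued.v : Valuation E ℤᵐ⁰) (algebraMap F E 2) = 1) :
    RamificationZero (Valued.v : Valuation E ℤᵐ⁰) (E ⊗[F] ℍ[F,s,0,t₁ * t₂]) := by
  have hmap : ∀ {x : F}, x ≠ 0 → algebraMap F E x ≠ 0 := fun hx => (map_ne_zero _).2 hx
  obtain ⟨e⟩ := baseChange_equiv h2 E hs (mul_ne_zero ht₁ ht₂)
  rw [map_mul] at e
  rw [map_ofNat] at hv2
  exact ramificationZero_of_nondyadic hv (Valuation.quadraticHensel_of_complete hv) hv2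
    (hmap hs) (hmap ht₁) (hmap ht₂)
    (fun r hr => ⟨represents_of_denseRange hd hv h2 (fun r hr => (hrep r hr).1) hr,
      represents_of_denseRange hd hv h2 (fun r hr => (hrep r hr).2) hr⟩) ⟨e.symm⟩

theorem not_ramificationNonzero_tensor (hd : DenseRange (algebraMap F E))
    (hv : Function.Surjective (Valued.v : Valuation E ℤᵐ⁰)) (h2 : (2 : F) ≠ 0)
    (hs : s ≠ 0) (ht₁ : t₁ ≠ 0) (ht₂ : t₂ ≠ 0)
    (hrep : ∀ r : F, r ≠ 0 → (Represents s t₁ r ↔ Represents s t₂ r))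
    (hv2 : (Valued.v : Valuation E ℤᵐ⁰) (algebraMap F E 2) < 1) :
    ¬ RamificationNonzero (Valued.v : Valuation E ℤᵐ⁰) (E ⊗[F] ℍ[F,s,0,t₁ * t₂]) := by
  have hmap : ∀ {x : F}, x ≠ 0 → algebraMap F E x ≠ 0 := fun hx => (map_ne_zero _).2 hx
  obtain ⟨e⟩ := baseChange_equiv h2 E hs (mul_ne_zero ht₁ ht₂)
  rw [map_mul] at e
  rw [map_ofNat] at hv2
  have h2E := hmap h2
  rw [map_ofNat] at h2E
  rintro ⟨L, _, _, w, χ, hχ, hχ0⟩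
  exact hχ0 (ramification_eq_zero_of_dyadic hv h2E hv2 (hmap hs) (hmap ht₁) (hmap ht₂)
    (fun r hr => ⟨represents_of_denseRange hd hv h2 (fun r hr => (hrep r hr).1) hr,
      represents_of_denseRange hd hv h2 (fun r hr => (hrep r hr).2) hr⟩) ⟨e.symm⟩ hχ)

end BaseChange

end QuaternionPair

end Completion

/-! ### Real closed fields -/

namespace QuaternionPair

/-- For `s` and `t'` negative the pure form is negative definite and cannot take a positive value.
-/
theorem not_represents_of_isSemireal {R : Type*} [Field R] [IsSemireal R] {s t t' : R}
    (hs : IsSquare (-s)) (ht : IsSquare t) (ht0 : t ≠ 0) (ht' : IsSquare (-t')) :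
    ¬ Represents s t' t := by
  rintro ⟨a, b, c, habc⟩
  obtain ⟨e, he⟩ := hs
  obtain ⟨p, rfl⟩ := ht
  obtain ⟨q, hq⟩ := ht'
  have hp : p ≠ 0 := by rintro rfl; simp at ht0
  refine IsSemireal.one_add_ne_zero (R := R) (((IsSumSq.mul_self (e * a / p)).add
    (IsSumSq.mul_self (q * b / p))).add (IsSumSq.mul_self (e * q * c / p))) ?_
  obtain rfl : s = -(e * e) := by linear_combination -he
  obtain rfl : t' = -(q * q) := by linear_combination -hq
  simp only [pureSq] at habc
  field_simp
  linear_combination -habc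

/-- If `s` is a square, everything is a norm. If `s` is negative, `t₁` and `t₂` have equal signs, so
`t₁ t₂` is a square. -/
theorem isNorm_of_isRealClosed {R : Type*} [Field R] [IsRealClosed R] {s t₁ t₂ : R}
    (h2 : (2 : R) ≠ 0) (hs : s ≠ 0) (ht₁ : t₁ ≠ 0) (ht₂ : t₂ ≠ 0) (h₁ : Represents s t₁ t₂)
    (h₂ : Represents s t₂ t₁) : IsNorm s (t₁ * t₂) := by
  rcases IsRealClosed.isSquare_or_isSquare_neg s with hs' | hs'
  · exact isNorm_of_isSquare h2 hs hs' _
  rcases IsRealClosed.isSquare_or_isSquare_neg t₁ with h | h <;>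
    rcases IsRealClosed.isSquare_or_isSquare_neg t₂ with h' | h'
  · obtain ⟨q, hq⟩ := h.mul h'
    exact ⟨q, 0, by rw [hq]; ring⟩
  · exact absurd h₂ (not_represents_of_isSemireal hs' h ht₁ h')
  · exact absurd h₁ (not_represents_of_isSemireal hs' h' ht₂ h)
  · obtain ⟨q, hq⟩ := h.mul h'
    exact ⟨q, 0, by linear_combination hq⟩

end QuaternionPair

/-! ### The main theorem -/

namespace QuaternionPair

theorem isUnramifiedClass {F : Type u} [Field F] (h2 : (2 : F) ≠ 0) {s t₁ t₂ : F} (hs : s ≠ 0)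
    (ht₁ : t₁ ≠ 0) (ht₂ : t₂ ≠ 0)
    (hrep : ∀ r : F, r ≠ 0 → (Represents s t₁ r ↔ Represents s t₂ r)) :
    IsUnramifiedClass F ℍ[F,s,0,t₁ * t₂] := by
  have ht := mul_ne_zero ht₁ ht₂
  refine ⟨fun v hv hd => ?_, fun R _ _ hR _ => ?_⟩
  · rw [isDyadic_iff, not_lt] at hd
    exact ramificationZero_tensor (denseRange_algebraMap_completion v)
      (completionValuation_surjective hv) h2 hs ht₁ ht₂ hrep
      ((completionValuation_algebraMap v 2).trans (le_antisymm Valuation.val_two_le hd))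
  · have hmap : ∀ {x : F}, x ≠ 0 → algebraMap F R x ≠ 0 := fun hx => (map_ne_zero _).2 hx
    have h2R : (2 : R) ≠ 0 := by
      rw [← map_ofNat (algebraMap F R) 2]
      exact hmap h2
    have hpure : ∀ t : F, Represents s t t := fun t => ⟨0, 1, 0, by simp [pureSq]⟩
    have hn := isNorm_of_isRealClosed h2R (hmap hs) (hmap ht₁) (hmap ht₂)
      (represents_map ((hrep t₂ ht₂).2 (hpure t₂))) (represents_map ((hrep t₁ ht₁).1 (hpure t₁)))
    rw [← map_mul] at hn
    obtain ⟨e⟩ := baseChange_equiv h2 R hs ht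
    obtain ⟨e'⟩ := iso_one_one_of_isNorm h2R (hmap hs) (hmap ht) hn
    obtain ⟨e''⟩ := matrix_equiv h2R
    exact ⟨2, two_ne_zero, ⟨(e.trans e').trans e''⟩⟩

/-- Over a transparent field, quaternion algebras with a common slot and the same values of the
pure norm form are isomorphic. -/
theorem isNorm_of_isTransparent {F : Type u} [Field F] (hF : IsTransparent F) (h2 : (2 : F) ≠ 0)
    {s t₁ t₂ : F} (hs : s ≠ 0) (ht₁ : t₁ ≠ 0) (ht₂ : t₂ ≠ 0)
    (hrep : ∀ r : F, r ≠ 0 → (Represents s t₁ r ↔ Represents s t₂ r)) :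
    IsNorm s (t₁ * t₂) := by
  by_contra hn
  have ht := mul_ne_zero ht₁ ht₂
  -- If `t₁ t₂` is not a norm, `(s, t₁ t₂)` is a division algebra to which transparency applies.
  let _ := divisionRing (isDivision_of_not_isNorm h2 hs hn)
  have := isCentral (t := t₁ * t₂) h2 hs
  obtain ⟨v, hv, hd, -, hram⟩ := hF ℍ[F,s,0,t₁ * t₂]
    (by rw [QuaternionAlgebra.finrank_eq_four]; norm_num) (isSplitAlgebra_tensor_self h2 hs ht)
    (isUnramifiedClass h2 hs ht₁ ht₂ hrep)
  exact not_ramificationNonzero_tensor (denseRange_algebraMap_completion v)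
    (completionValuation_surjective hv) h2 hs ht₁ ht₂ hrep
    ((completionValuation_algebraMap v 2).trans_lt ((isDyadic_iff v).1 hd)) hram

end QuaternionPair

open QuaternionPair

theorem theorem1p1 (F : Type*) [Field F] (hchar : ringChar F ≠ 2) (htransparent : IsTransparent F)
    (D₁ D₂ : Type*) [DivisionRing D₁] [Algebra F D₁] [DivisionRing D₂] [Algebra F D₂]
    [Algebra.IsCentral F D₁] [Algebra.IsCentral F D₂]
    (hdim₁ : Module.finrank F D₁ = 4) (hdim₂ : Module.finrank F D₂ = 4)
    (hsame : HaveSameMaximalSubfields F D₁ D₂) :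
    Nonempty (D₁ ≃ₐ[F] D₂) := by
  have h2 : (2 : F) ≠ 0 := Ring.two_ne_zero hchar
  have h₁₂ := fun {y s} => exists_sq_of_maximalSubfields (D₂ := D₂) h2 hdim₁ hsame.1 (y := y) (s := s)
  have h₂₁ := fun {y s} => exists_sq_of_maximalSubfields (D₂ := D₁) h2 hdim₂
    (fun K hK => by
      obtain ⟨K', hK', ⟨φ⟩⟩ := hsame.2 K hK
      exact ⟨K', hK', ⟨φ.symm⟩⟩) (y := y) (s := s)
  obtain ⟨y₁, s, hy₁, hy₁F⟩ := exists_noncentral_sq h2 hdim₁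
  obtain ⟨y₂, hy₂, hy₂F⟩ := h₁₂ hy₁ hy₁F
  obtain ⟨t₁, ht₁, e₁, -⟩ := exists_quaternion_basis_of_sq h2 hdim₁ hy₁ hy₁F
  obtain ⟨t₂, ht₂, e₂, -⟩ := exists_quaternion_basis_of_sq h2 hdim₂ hy₂ hy₂F
  have hs : s ≠ 0 := by
    rintro rfl
    rw [map_zero] at hy₁
    exact hy₁F ⟨0, by rw [map_zero, mul_self_eq_zero.1 hy₁]⟩
  have hrep : ∀ r : F, r ≠ 0 → (Represents s t₁ r ↔ Represents s t₂ r) := by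
    refine fun r hr => ⟨fun h => ?_, fun h => ?_⟩
    · obtain ⟨x, hx, hxF⟩ := exists_sq_of_represents hr e₁ h
      obtain ⟨z, hz, hzF⟩ := h₁₂ hx hxF
      exact represents_of_equiv h2 e₂ hz hzF
    · obtain ⟨x, hx, hxF⟩ := exists_sq_of_represents hr e₂ h
      obtain ⟨z, hz, hzF⟩ := h₂₁ hx hxF
      exact represents_of_equiv h2 e₁ hz hzF
  obtain ⟨x, y, hxy⟩ := isNorm_of_isTransparent htransparent h2 hs ht₁ ht₂ hrep
  -- `t₂ = t₁ · (t₁ t₂) / t₁²` is `t₁` times a norm.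
  obtain ⟨e⟩ := iso_mul_norm_right (t := t₁) (t' := t₂) h2 hs ht₂ (x := x / t₁) (y := y / t₁) (by
    field_simp
    linear_combination hxy)
  exact ⟨e₁.symm.trans (e.trans e₂)⟩
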